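/- Let $R$ be a Noetherian integral domain with quotient field $K$. For $R$-submodules (or, over an overring $B$ of $R$, $B$-submodules) $I,J$ of $K$ put $(I:J)=\{x\in K : xJ\subseteq I\}$. For a domain $A$ with quotient field $K$ and a nonzero fractional ideal $I$ of $A$ put $I^{-1}=(A:I)$, $I_v=(I^{-1})^{-1}$ and $I_t=\bigcup J_v$, where $J$ ranges over the nonzero finitely generated $A$-submodules of $I$. A $t$-ideal of $A$ is a nonzero fractional ideal $I$ with $I=I_t$, and $I$ is $t$-invertible in $A$ if $(I(A:I))_t=A$. Let $\mathcal S_t(R)$ be the $t$-class semigroup of $R$: the commutative semigroup of $t$-ideals of $R$ under $(I,J)\mapsto (IJ)_t$, modulo nonzero principal fractional ideals (so $I$ and $J$ are identified iff $J=cI$ for some $0\ne c\in K$). $R$ is Clifford $t$-regular if every $x\in\mathcal S_t(R)$ is von Neumann regular, i.e. $x=ax^2$ for some $a\in\mathcal S_t(R)$. A $t$-ideal $I$ is Lipman-stable (L-stable) if $\bigcup_{n\ge 1}(I^n:I^n)=(I:I)$. The $t$-dimension $t\text{-}\dim(R)$ is the supremum of the lengths of chains of $t$-prime ideals of $R$,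 a $t$-prime ideal being a prime ideal that is either zero or a $t$-ideal. Theorem. Consider the following statements: 1. $R$ is Clifford $t$-regular; 2. each $t$-ideal $I$ of $R$ is $t$-invertible as a fractional ideal of its endomorphism ring $(I:I)$; 3. each $t$-ideal of $R$ is L-stable. Then $(1)\Rightarrow(2)\Rightarrow(3)$. Moreover, if $t\text{-}\dim(R)=1$, then $(3)\Rightarrow(1)$. -/

import Mathlib

open scoped nonZeroDivisors

namespace TClass

section Closures

variable {A K : Type*} [CommRing A] [Field K] [Algebra A K]

/-- The `v`-closure `(I⁻¹)⁻¹`, where `I⁻¹ = (A : I)`. Here `1` is the image of `A` in `K`, and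
`I / J` is the colon `(I : J) = {x ∈ K | x J ⊆ I}`. -/
def vClosure (I : Submodule A K) : Submodule A K := 1 / (1 / I)

/-- The `t`-closure of `I`: the union (a directed supremum) of the `v`-closures of the nonzero
finitely generated `A`-submodules of `I`. -/
def tClosure (I : Submodule A K) : Submodule A K :=
  ⨆ J : {J : Submodule A K // J ≠ ⊥ ∧ J.FG ∧ J ≤ I}, vClosure J.1

/-- `I ⊆ K` is a (fractional) `t`-ideal of `A`: a nonzero fractional ideal with `I = I_t`. -/
def IsTIdeal (I : Submodule A K) : Prop :=
  I ≠ ⊥ ∧ IsFractional A⁰ I ∧ tClosure I = I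

/-- `I` is `t`-invertible in `A`: `(I (A : I))_t = A`. -/
def IsTInvertible (I : Submodule A K) : Prop :=
  tClosure (I * (1 / I)) = 1

/-- `I` is Lipman-stable: the union of the `(Iⁿ : Iⁿ)` over `n ≥ 1` equals `(I : I)`. -/
def IsLStable (I : Submodule A K) : Prop :=
  (⋃ (n : ℕ) (_ : 1 ≤ n), ((I ^ n / I ^ n : Submodule A K) : Set K)) =
    ((I / I : Submodule A K) : Set K)

/-- The ring `(I : I)`, an overring of `A` in `K` when `I` is nonzero and fractional. -/
def endRing (I : Submodule A K) : Subalgebra A K where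
  carrier := {x | ∀ y ∈ I, x * y ∈ I}
  mul_mem' {a b} ha hb y hy := by
    rw [mul_assoc]
    exact ha _ (hb _ hy)
  add_mem' {a b} ha hb y hy := by
    rw [add_mul]
    exact I.add_mem (ha _ hy) (hb _ hy)
  algebraMap_mem' r y hy := by
    rw [← Algebra.smul_def]
    exact I.smul_mem r hy

/-- `I` regarded as a module over the ring `(I : I)`. -/
def overEndRing (I : Submodule A K) : Submodule (endRing I) K where
  carrier := I
  add_mem' ha hb := I.add_mem ha hb
  zero_mem' := I.zero_mem
  smul_mem' c x hx := c.2 x hx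

theorem one_div_anti {I J : Submodule A K} (h : I ≤ J) : 1 / J ≤ 1 / I := by
  rw [Submodule.le_div_iff_mul_le]
  exact (mul_le_mul' le_rfl h).trans (Submodule.le_div_iff_mul_le.1 le_rfl)

theorem vClosure_mono {I J : Submodule A K} (h : I ≤ J) : vClosure I ≤ vClosure J :=
  one_div_anti (one_div_anti h)

theorem le_vClosure (I : Submodule A K) : I ≤ vClosure I :=
  Submodule.le_div_iff_mul_le.2 Submodule.mul_one_div_le_one

theorem vClosure_mul_le (I J : Submodule A K) : vClosure I * J ≤ vClosure (I * J) := by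
  refine Submodule.le_div_iff_mul_le.2 ?_
  have h1 : J * (1 / (I * J)) ≤ 1 / I := by
    refine Submodule.le_div_iff_mul_le.2 ?_
    calc J * (1 / (I * J)) * I = (1 / (I * J)) * (I * J) := by ring
      _ ≤ 1 := Submodule.le_div_iff_mul_le.1 le_rfl
  calc vClosure I * J * (1 / (I * J)) = vClosure I * (J * (1 / (I * J))) := by ring
    _ ≤ vClosure I * (1 / I) := mul_le_mul' le_rfl h1
    _ ≤ 1 := Submodule.le_div_iff_mul_le.1 le_rfl

theorem vClosure_le_vClosure {I J : Submodule A K} (h : I ≤ vClosure J) :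
    vClosure I ≤ vClosure J := by
  refine one_div_anti (Submodule.le_div_iff_mul_le.2 ?_)
  calc 1 / J * I ≤ 1 / J * vClosure J := mul_le_mul' le_rfl h
    _ = vClosure J * (1 / J) := mul_comm _ _
    _ ≤ 1 := Submodule.le_div_iff_mul_le.1 le_rfl

theorem vClosure_le_tClosure {I J : Submodule A K} (h0 : J ≠ ⊥) (hf : J.FG) (h : J ≤ I) :
    vClosure J ≤ tClosure I :=
  le_iSup (fun J : {J : Submodule A K // J ≠ ⊥ ∧ J.FG ∧ J ≤ I} => vClosure J.1) ⟨J, h0, hf, h⟩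

theorem tClosure_mono {I J : Submodule A K} (h : I ≤ J) : tClosure I ≤ tClosure J :=
  iSup_le fun F => vClosure_le_tClosure F.2.1 F.2.2.1 (F.2.2.2.trans h)

theorem le_tClosure (I : Submodule A K) : I ≤ tClosure I := by
  intro x hx
  by_cases h0 : x = 0
  · rw [h0]
    exact Submodule.zero_mem _
  · refine vClosure_le_tClosure (J := Submodule.span A {x}) ?_ (Submodule.fg_span_singleton x) ?_
      (le_vClosure _ (Submodule.mem_span_singleton_self x))
    · simpa using h0
    · simpa using hx

theorem directed_vClosure (I : Submodule A K) : Directed (· ≤ ·)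
    (fun J : {J : Submodule A K // J ≠ ⊥ ∧ J.FG ∧ J ≤ I} => vClosure J.1) := by
  intro F G
  refine ⟨⟨F.1 ⊔ G.1, ?_, F.2.2.1.sup G.2.2.1, sup_le F.2.2.2 G.2.2.2⟩,
    vClosure_mono le_sup_left, vClosure_mono le_sup_right⟩
  intro h
  exact F.2.1 (sup_eq_bot_iff.1 h).1

/-- The `t`-closure is the union of the `v`-closures over which it ranges. -/
theorem mem_tClosure {I : Submodule A K} (hI : I ≠ ⊥) {x : K} :
    x ∈ tClosure I ↔ ∃ J : Submodule A K, J ≠ ⊥ ∧ J.FG ∧ J ≤ I ∧ x ∈ vClosure J := by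
  obtain ⟨y, hy, hy0⟩ := (Submodule.ne_bot_iff I).1 hI
  have : Nonempty {J : Submodule A K // J ≠ ⊥ ∧ J.FG ∧ J ≤ I} :=
    ⟨⟨Submodule.span A {y}, by simpa using hy0, Submodule.fg_span_singleton y, by simpa using hy⟩⟩
  unfold tClosure
  rw [Submodule.mem_iSup_of_directed _ (directed_vClosure I)]
  constructor
  · rintro ⟨J, hJ⟩
    exact ⟨J.1, J.2.1, J.2.2.1, J.2.2.2, hJ⟩
  · rintro ⟨J, h1, h2, h3, h4⟩
    exact ⟨⟨J, h1, h2, h3⟩, h4⟩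

theorem exists_fg_of_le_tClosure {I F : Submodule A K} (hI : I ≠ ⊥) (hF : F.FG)
    (h : F ≤ tClosure I) :
    ∃ J : Submodule A K, J ≠ ⊥ ∧ J.FG ∧ J ≤ I ∧ F ≤ vClosure J := by
  obtain ⟨y, hy, hy0⟩ := (Submodule.ne_bot_iff I).1 hI
  induction F, hF using Submodule.fg_induction with
  | singleton x =>
    obtain ⟨J, h1, h2, h3, h4⟩ := (mem_tClosure hI).1 (h (Submodule.mem_span_singleton_self x))
    exact ⟨J, h1, h2, h3, by simpa using h4⟩
  | sup F G _ _ hF hG =>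
    obtain ⟨J, h1, h2, h3, h4⟩ := hF (le_sup_left.trans h)
    obtain ⟨J', _, h2', h3', h4'⟩ := hG (le_sup_right.trans h)
    exact ⟨J ⊔ J', fun e => h1 (sup_eq_bot_iff.1 e).1, h2.sup h2', sup_le h3 h3',
      sup_le (h4.trans (vClosure_mono le_sup_left)) (h4'.trans (vClosure_mono le_sup_right))⟩

theorem tClosure_bot : tClosure (⊥ : Submodule A K) = ⊥ :=
  le_bot_iff.1 (iSup_le fun F => (F.2.1 (le_bot_iff.1 F.2.2.2)).elim)

theorem tClosure_idem (I : Submodule A K) : tClosure (tClosure I) = tClosure I := by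
  by_cases hI : I = ⊥
  · rw [hI, tClosure_bot, tClosure_bot]
  · refine le_antisymm (iSup_le fun F => ?_) (le_tClosure _)
    obtain ⟨J, h1, h2, h3, h4⟩ := exists_fg_of_le_tClosure hI F.2.2.1 F.2.2.2
    exact (vClosure_le_vClosure h4).trans (vClosure_le_tClosure h1 h2 h3)

theorem mul_ne_bot' {I J : Submodule A K} (hI : I ≠ ⊥) (hJ : J ≠ ⊥) : I * J ≠ ⊥ := by
  obtain ⟨x, hx, hx0⟩ := (Submodule.ne_bot_iff I).1 hI
  obtain ⟨y, hy, hy0⟩ := (Submodule.ne_bot_iff J).1 hJ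
  exact (Submodule.ne_bot_iff _).2 ⟨x * y, Submodule.mul_mem_mul hx hy, mul_ne_zero hx0 hy0⟩

theorem tClosure_mul_le (I J : Submodule A K) : tClosure I * J ≤ tClosure (I * J) := by
  refine Submodule.mul_le.2 fun m hm n hn => ?_
  by_cases h0 : n = 0
  · rw [h0, mul_zero]
    exact Submodule.zero_mem _
  have key : tClosure I * Submodule.span A {n} ≤ tClosure (I * J) := by
    unfold tClosure
    rw [Submodule.iSup_mul]
    refine iSup_le fun F => (vClosure_mul_le _ _).trans ?_
    refine vClosure_le_tClosure (mul_ne_bot' F.2.1 (by simpa using h0))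
      (F.2.2.1.mul (Submodule.fg_span_singleton n)) (mul_le_mul' F.2.2.2 (by simpa using hn))
  exact key (Submodule.mul_mem_mul hm (Submodule.mem_span_singleton_self n))

theorem tClosure_tClosure_mul (I J : Submodule A K) :
    tClosure (tClosure I * J) = tClosure (I * J) := by
  refine le_antisymm ?_ (tClosure_mono (mul_le_mul' (le_tClosure I) le_rfl))
  calc tClosure (tClosure I * J) ≤ tClosure (tClosure (I * J)) :=
        tClosure_mono (tClosure_mul_le I J)
    _ = tClosure (I * J) := tClosure_idem _

theorem span_inv_mul {c : K} (hc : c ≠ 0) :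
    Submodule.span A {c⁻¹} * Submodule.span A {c} = 1 := by
  rw [Submodule.span_mul_span, Set.singleton_mul_singleton, inv_mul_cancel₀ hc,
    Submodule.one_eq_span]

theorem tClosure_span_mul {c : K} (hc : c ≠ 0) (I : Submodule A K) :
    tClosure (Submodule.span A {c} * I) = Submodule.span A {c} * tClosure I := by
  refine le_antisymm ?_ ?_
  · have h := tClosure_mul_le (Submodule.span A {c} * I) (Submodule.span A {c⁻¹})
    have e : Submodule.span A {c} * I * Submodule.span A {c⁻¹} = I := by
      calc Submodule.span A {c} * I * Submodule.span A {c⁻¹}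
          = Submodule.span A {c⁻¹} * Submodule.span A {c} * I := by ring
        _ = I := by rw [span_inv_mul hc, one_mul]
    rw [e] at h
    calc tClosure (Submodule.span A {c} * I)
        = Submodule.span A {c⁻¹} * Submodule.span A {c} *
            tClosure (Submodule.span A {c} * I) := by rw [span_inv_mul hc, one_mul]
      _ = Submodule.span A {c} *
            (tClosure (Submodule.span A {c} * I) * Submodule.span A {c⁻¹}) := by ring
      _ ≤ _ := mul_le_mul' le_rfl h
  · have h := tClosure_mul_le I (Submodule.span A {c})
    rwa [mul_comm, mul_comm I] at h

theorem tClosure_one : tClosure (1 : Submodule A K) = 1 := by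
  refine le_antisymm (iSup_le fun F => (vClosure_mono F.2.2.2).trans ?_) (le_tClosure _)
  have h1 : (1 : Submodule A K) ≤ 1 / 1 := Submodule.le_div_iff_mul_le.2 (by rw [mul_one])
  calc vClosure (1 : Submodule A K) = vClosure 1 * 1 := (mul_one _).symm
    _ ≤ vClosure 1 * (1 / 1) := mul_le_mul' le_rfl h1
    _ ≤ 1 := Submodule.le_div_iff_mul_le.1 le_rfl

theorem isFractional_tClosure {I : Submodule A K} (h : IsFractional A⁰ I) :
    IsFractional A⁰ (tClosure I) := by
  obtain ⟨a, ha, hI⟩ := h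
  refine ⟨a, ha, fun b hb => ?_⟩
  have h1 : I * Submodule.span A {algebraMap A K a} ≤ 1 := by
    refine Submodule.mul_le.2 fun m hm n hn => ?_
    obtain ⟨r, rfl⟩ := Submodule.mem_span_singleton.1 hn
    obtain ⟨s, hs⟩ := hI m hm
    refine Submodule.mem_one.2 ⟨r * s, ?_⟩
    rw [map_mul, hs, Algebra.smul_def, Algebra.smul_def]
    ring
  have h2 : tClosure I * Submodule.span A {algebraMap A K a} ≤ 1 :=
    (tClosure_mul_le _ _).trans ((tClosure_mono h1).trans tClosure_one.le)
  obtain ⟨s, hs⟩ := Submodule.mem_one.1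
    (h2 (Submodule.mul_mem_mul hb (Submodule.mem_span_singleton_self _)))
  exact ⟨s, by rw [hs, Algebra.smul_def, mul_comm]⟩

/-- The `t`-product of two `t`-ideals is a `t`-ideal. -/
theorem IsTIdeal.tmul {I J : Submodule A K} (hI : IsTIdeal I) (hJ : IsTIdeal J) :
    IsTIdeal (tClosure (I * J)) :=
  ⟨fun h => mul_ne_bot' hI.1 hJ.1 (le_bot_iff.1 (h ▸ le_tClosure (I * J))),
    isFractional_tClosure (hI.2.1.mul hJ.2.1), tClosure_idem _⟩

end Closures

section ClassSemigroup

variable (R K : Type*) [CommRing R] [Field K] [Algebra R K]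

/-- The fractional `t`-ideals of `R`. -/
abbrev TIdeal : Type _ := {I : Submodule R K // IsTIdeal I}

variable {R K} in
/-- `t`-multiplication, `(I, J) ↦ (I J)_t`. -/
instance : Mul (TIdeal R K) where
  mul I J := ⟨tClosure (I.1 * J.1), I.2.tmul J.2⟩

/-- The semigroup of fractional `t`-ideals under `t`-multiplication. -/
instance : CommSemigroup (TIdeal R K) where
  mul_assoc I J L := Subtype.ext <| by
    change tClosure (tClosure (I.1 * J.1) * L.1) = tClosure (I.1 * tClosure (J.1 * L.1))
    rw [tClosure_tClosure_mul, mul_comm I.1 (tClosure _), tClosure_tClosure_mul]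
    congr 1
    ring
  mul_comm I J := Subtype.ext <| by
    change tClosure (I.1 * J.1) = tClosure (J.1 * I.1)
    rw [mul_comm]

/-- Two `t`-ideals are identified when they differ by a nonzero principal fractional ideal,
`J = c I` with `0 ≠ c ∈ K`; this is a congruence for `t`-multiplication. -/
def principalCon : Con (TIdeal R K) where
  r I J := ∃ c : K, c ≠ 0 ∧ J.1 = Submodule.span R {c} * I.1
  iseqv :=
    { refl := fun I => ⟨1, one_ne_zero, by rw [← Submodule.one_eq_span, one_mul]⟩
      symm := by
        rintro I J ⟨c, hc, h⟩
        exact ⟨c⁻¹, inv_ne_zero hc, by rw [h, ← mul_assoc, span_inv_mul hc, one_mul]⟩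
      trans := by
        rintro I J L ⟨c, hc, h⟩ ⟨d, hd, h'⟩
        refine ⟨d * c, mul_ne_zero hd hc, ?_⟩
        rw [h', h, ← mul_assoc, Submodule.span_mul_span, Set.singleton_mul_singleton] }
  mul' := by
    rintro I I' J J' ⟨c, hc, h⟩ ⟨d, hd, h'⟩
    refine ⟨c * d, mul_ne_zero hc hd, ?_⟩
    change tClosure (I'.1 * J'.1) = Submodule.span R {c * d} * tClosure (I.1 * J.1)
    rw [← tClosure_span_mul (mul_ne_zero hc hd), h, h', ← Set.singleton_mul_singleton,
      ← Submodule.span_mul_span]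
    congr 1
    ring

/-- The `t`-class semigroup `S_t(R)`: fractional `t`-ideals modulo nonzero principal ideals,
with the (commutative semigroup) operation induced by `t`-multiplication. -/
abbrev TClassSemigroup : Type _ := (principalCon R K).Quotient

/-- A commutative semigroup is Clifford if every element is von Neumann regular. -/
def IsCliffordSemigroup (S : Type*) [CommSemigroup S] : Prop :=
  ∀ x : S, ∃ a : S, x = a * (x * x)

/-- `R` (with quotient field `K`) is Clifford `t`-regular. -/
def IsCliffordTRegular : Prop := IsCliffordSemigroup (TClassSemigroup R K)

/-- `P` is a `t`-prime ideal: a prime ideal that is zero or a `t`-ideal. -/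
def IsTPrime (P : Ideal R) : Prop :=
  P.IsPrime ∧ (P = ⊥ ∨ IsTIdeal (IsLocalization.coeSubmodule K P))

/-- The `t`-dimension of `R`: the supremum of the lengths of the finite chains
`P₀ ⊂ ⋯ ⊂ Pₙ` of `t`-prime ideals. -/
noncomputable def tDim : WithBot ℕ∞ := Order.krullDim {P : Ideal R // IsTPrime R K P}

end ClassSemigroup

end TClass

namespace TClass

/-! ### Regularity, `t`-invertibility over `(I : I)`, and Lipman stability. -/

section Conductor

variable {R K : Type*} [CommRing R] [Field K] [Algebra R K]

/-! Write `T = (I : I)`. If `(J I²)_t = I`, then `J ⊆ (T : I)`, and any `x` multiplying `I (T : I)`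
into `T` sends `J I²` into `I`, hence `I` into `I`; so this finitely generated ideal of `T` has
inverse `T`, and `I` is `t`-invertible over `T`. In turn `t`-invertibility passes to powers, so `(Iⁿ
: Iⁿ)` cannot exceed `T`.

For the converse, `(I : I²)` is the quasi-inverse. In `t`-dimension one, nonzero `t`-primes have
height one, so it suffices to show that `I` agrees with `(I : I²) I²` locally at each height one
prime `P`: the conductor of `I` into `(I : I²) I²` then lies in no nonzero `t`-prime, so its
`t`-closure is `R` (`tClosure_div_mul_eq`). The local statement is that `I` is invertible in its
blow-up ring at `P` (`exists_notMem_mem_mul_div`), and stability replaces the blow-up ring by `T`.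

Classically, invertibility in the blow-up follows from a superficial element of `I`, which needs a
large residue field. Here a polynomial `f` with content `I` serves as a generic element. In the
fiber ring `⨁ Iᵐ / P Iᵐ`, localized at `P` and freed of irrelevant torsion, multiplication by `f` is
injective by Dedekind–Mertens (`negligible_content_of_mul`), and the ranks are bounded by a length
(`exists_card_le_of_independent`). In a degree of maximal rank, Cramer's rule makes this
multiplication surjective up to a polynomial nonzero modulo `P` (`exists_reduces_of_independent`);
raising the degree kills the torsion, and Nakayama (`exists_map_mul_C_eq_mul`) gives `g Iᵐ⁺¹ ⊆ f
Iᵐ[X]`. A coefficient of `g` outside `P` is the required element. -/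

theorem tClosure_le_of_le {I J : Submodule R K} (hI : IsTIdeal I) (h : J ≤ I) :
    tClosure J ≤ I :=
  (tClosure_mono h).trans hI.2.2.le

/-- The hypotheses force `1 / X = 1`. For finitely generated nonzero `X` this makes the `t`-closure
trivial too, which is how both uses go. -/
theorem vClosure_eq_one_of_one_div_le {X : Submodule R K} (h : X ≤ 1) (h' : 1 / X ≤ 1) :
    vClosure X = 1 := by
  refine le_antisymm ?_ (Submodule.le_div_iff_mul_le.2 (by rwa [one_mul]))
  have : (1 : Submodule R K) ≤ 1 / X := Submodule.le_div_iff_mul_le.2 (by rwa [one_mul])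
  calc vClosure X = vClosure X * 1 := (mul_one _).symm
    _ ≤ vClosure X * (1 / X) := mul_le_mul' le_rfl this
    _ ≤ 1 := Submodule.le_div_iff_mul_le.1 le_rfl

theorem mem_one_endRing {I : Submodule R K} {x : K} :
    x ∈ (1 : Submodule (endRing I) K) ↔ ∀ y ∈ I, x * y ∈ I := by
  rw [Submodule.mem_one]
  exact ⟨by rintro ⟨y, rfl⟩; exact y.2, fun h => ⟨⟨x, h⟩, rfl⟩⟩

theorem mem_div_self {I : Submodule R K} {x : K} : x ∈ I / I ↔ ∀ y ∈ I, x * y ∈ I :=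
  Submodule.mem_div_iff_forall_mul_mem

/-- Classes agree only up to a scalar `c`, which is absorbed into the representative `J`. -/
theorem exists_tClosure_mul_eq (h : IsCliffordTRegular R K) {I : Submodule R K}
    (hI : IsTIdeal I) : ∃ J : Submodule R K, tClosure (J * (I * I)) = I := by
  obtain ⟨a, ha⟩ := h ((⟨I, hI⟩ : TIdeal R K) : (principalCon R K).Quotient)
  induction a using Con.induction_on with
  | H J =>
    rw [← Con.coe_mul, ← Con.coe_mul, Con.eq] at ha
    obtain ⟨c, hc, h⟩ := ha
    change tClosure (J.1 * tClosure (I * I)) = Submodule.span R {c} * I at h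
    refine ⟨Submodule.span R {c⁻¹} * J.1, ?_⟩
    rw [mul_assoc, tClosure_span_mul (inv_ne_zero hc), mul_comm J.1, ← tClosure_tClosure_mul,
      mul_comm _ J.1, h, ← mul_assoc, span_inv_mul hc, one_mul]

theorem isCliffordTRegular_of_forall
    (h : ∀ I : Submodule R K, IsTIdeal I →
      ∃ J : Submodule R K, J ≠ ⊥ ∧ IsFractional R⁰ J ∧ tClosure (J * (I * I)) = I) :
    IsCliffordTRegular R K := by
  intro x
  induction x using Con.induction_on with
  | H I =>
    obtain ⟨J, h0, hf, hJ⟩ := h I.1 I.2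
    refine ⟨((⟨tClosure J, ne_bot_of_le_ne_bot h0 (le_tClosure J), isFractional_tClosure hf,
      tClosure_idem J⟩ : TIdeal R K) : (principalCon R K).Quotient), ?_⟩
    rw [← Con.coe_mul, ← Con.coe_mul]
    congr 1
    refine Subtype.ext ?_
    change I.1 = tClosure (tClosure J * tClosure (I.1 * I.1))
    rw [tClosure_tClosure_mul, mul_comm, tClosure_tClosure_mul, mul_comm, hJ]

/-- Multiplication by `x` is compatible with `t`-closure, so landing in a `t`-ideal can be tested on
`F`. -/
theorem mem_of_forall_mul_mem {I F : Submodule R K} (hI : IsTIdeal I) {x : K}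
    (h : ∀ y ∈ F, x * y ∈ I) {y : K} (hy : y ∈ tClosure F) : x * y ∈ I := by
  have h1 : F * Submodule.span R {x} ≤ I := by
    refine Submodule.mul_le.2 fun m hm n hn => ?_
    obtain ⟨r, rfl⟩ := Submodule.mem_span_singleton.1 hn
    rw [mul_smul_comm, mul_comm]
    exact I.smul_mem r (h m hm)
  rw [mul_comm]
  exact tClosure_le_of_le hI h1
    (tClosure_mul_le _ _ (Submodule.mul_mem_mul hy (Submodule.mem_span_singleton_self x)))

/-- All powers of `X = I (T : I)`, with `T = (I : I)`, have `t`-closure `T`. If `x` stabilizes `Iⁿ`,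
then `x Xⁿ ⊆ Xⁿ ⊆ T`, and taking `t`-closures gives `x ∈ T`. -/
theorem isLStable_of_isTInvertible {I : Submodule R K}
    (hI : IsTInvertible (overEndRing I)) : IsLStable I := by
  -- The zeroth power is excluded: it is `(I : I)` on the left and `R` on the right.
  have hpow : ∀ n : ℕ, n ≠ 0 → ((overEndRing I) ^ n).restrictScalars R = I ^ n := fun n hn =>
    Submodule.restrictScalars_pow hn
  refine Set.Subset.antisymm (Set.iUnion₂_subset fun n hn x hx => ?_) ?_
  · have hn0 : n ≠ 0 := by omega
    set U := overEndRing I with hU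
    set X : Submodule (endRing I) K := U * (1 / U) with hX
    have hX1 : X ≤ 1 := Submodule.mul_one_div_le_one
    have hXt : ∀ k : ℕ, tClosure (X ^ k) = 1 := by
      intro k
      induction k with
      | zero => rw [pow_zero, tClosure_one]
      | succ k ih =>
        rw [pow_succ, ← tClosure_tClosure_mul, ih, one_mul]
        exact hI
    have h1 : Submodule.span (endRing I) {x} * X ^ n ≤ 1 := by
      have h2 : Submodule.span (endRing I) {x} * U ^ n ≤ U ^ n := by
        refine Submodule.mul_le.2 fun m hm z hz => ?_
        obtain ⟨r, rfl⟩ := Submodule.mem_span_singleton.1 hm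
        rw [smul_mul_assoc]
        refine Submodule.smul_mem _ r ?_
        have hz' : z ∈ I ^ n := by rw [← hpow n hn0]; exact hz
        have := Submodule.mem_div_iff_forall_mul_mem.1 hx z hz'
        rw [← hpow n hn0] at this
        exact this
      calc Submodule.span (endRing I) {x} * X ^ n
          = Submodule.span (endRing I) {x} * U ^ n * (1 / U) ^ n := by
            rw [hX, mul_pow, mul_assoc]
        _ ≤ U ^ n * (1 / U) ^ n := mul_le_mul' h2 le_rfl
        _ = X ^ n := by rw [hX, mul_pow]
        _ ≤ 1 := pow_le_one' hX1 n
    have h3 : Submodule.span (endRing I) {x} ≤ 1 := by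
      calc Submodule.span (endRing I) {x} = tClosure (X ^ n) * Submodule.span (endRing I) {x} := by
            rw [hXt, one_mul]
        _ ≤ tClosure (X ^ n * Submodule.span (endRing I) {x}) := tClosure_mul_le _ _
        _ ≤ tClosure 1 := tClosure_mono (by rwa [mul_comm])
        _ = 1 := tClosure_one
    exact mem_div_self.2 (mem_one_endRing.1 (h3 (Submodule.mem_span_singleton_self x)))
  · intro x hx
    refine Set.mem_iUnion₂.2 ⟨1, le_rfl, ?_⟩
    rwa [pow_one]

variable [IsDomain R] [IsNoetherianRing R] [IsFractionRing R K]

theorem fg_of_isFractional {I : Submodule R K} (hI : IsFractional R⁰ I) : I.FG :=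
  isNoetherian_submodule.1 (FractionalIdeal.isNoetherian (⟨I, hI⟩ : FractionalIdeal R⁰ K)) I le_rfl

theorem isTInvertible_overEndRing {I J : Submodule R K} (hI : IsTIdeal I)
    (hJ : tClosure (J * (I * I)) = I) : IsTInvertible (overEndRing I) := by
  have hJW : ∀ j ∈ J, j ∈ 1 / overEndRing I := by
    refine fun j hj => Submodule.mem_div_iff_forall_mul_mem.2 fun y hy => mem_one_endRing.2 ?_
    intro z hz
    rw [mul_assoc, ← hJ]
    exact le_tClosure _ (Submodule.mul_mem_mul hj (Submodule.mul_mem_mul hy hz))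
  obtain ⟨i, hi, hi0⟩ := (Submodule.ne_bot_iff I).1 hI.1
  have hJ0 : J ≠ ⊥ := by
    rintro rfl
    rw [Submodule.bot_mul, tClosure_bot] at hJ
    exact hI.1 hJ.symm
  obtain ⟨j, hj, hj0⟩ := (Submodule.ne_bot_iff J).1 hJ0
  set X := overEndRing I * (1 / overEndRing I) with hX
  have hX1 : X ≤ 1 := Submodule.mul_one_div_le_one
  have hX0 : X ≠ ⊥ := mul_ne_bot' ((Submodule.ne_bot_iff _).2 ⟨i, hi, hi0⟩)
    ((Submodule.ne_bot_iff _).2 ⟨j, hJW j hj, hj0⟩)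
  have hXfg : X.FG := by
    -- `X i ⊆ I`, so `X` lies in `i⁻¹ I`, a Noetherian `R`-module.
    refine Submodule.FG.of_restrictScalars R (((Submodule.fg_span_singleton i⁻¹).mul
      (fg_of_isFractional hI.2.1)).of_le fun x hx => ?_)
    have := Submodule.mul_mem_mul (Submodule.mem_span_singleton_self (R := R) i⁻¹)
      (mem_one_endRing.1 (hX1 hx) i hi)
    rwa [mul_comm x, inv_mul_cancel_left₀ hi0] at this
  have hinv : 1 / X ≤ 1 := by
    intro x hx
    refine mem_one_endRing.2 fun y hy => ?_
    rw [← hJ] at hy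
    refine mem_of_forall_mul_mem hI (fun z hz => ?_) hy
    induction hz using Submodule.mul_induction_on' with
    | mem_mul_mem j hj w hw =>
      induction hw using Submodule.mul_induction_on' with
      | mem_mul_mem a ha b hb =>
        have := mem_one_endRing.1 (Submodule.mem_div_iff_forall_mul_mem.1 hx (a * j)
          (Submodule.mul_mem_mul ha (hJW j hj))) b hb
        convert this using 1
        ring
      | add a _ b _ h1 h2 =>
        rw [mul_add, mul_add]
        exact I.add_mem h1 h2
    | add a _ b _ h1 h2 =>
      rw [mul_add]
      exact I.add_mem h1 h2
  refine le_antisymm ((tClosure_mono hX1).trans tClosure_one.le) ?_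
  refine (vClosure_eq_one_of_one_div_le hX1 hinv).ge.trans ?_
  exact vClosure_le_tClosure hX0 hXfg le_rfl

end Conductor

open Polynomial

/-! ### Contents of polynomials and a Dedekind–Mertens lemma. -/

section Content

variable {R K : Type*} [CommRing R] [Field K] [Algebra R K]

variable (R) in
/-- The `R`-submodule of `K` generated by the coefficients of a polynomial over `K`. -/
def content (p : K[X]) : Submodule R K := Submodule.span R (Set.range p.coeff)

theorem content_le {p : K[X]} {N : Submodule R K} : content R p ≤ N ↔ ∀ i, p.coeff i ∈ N := by
  rw [content, Submodule.span_le, Set.range_subset_iff]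
  rfl

theorem coeff_mem_content (p : K[X]) (i : ℕ) : p.coeff i ∈ content R p :=
  content_le.1 le_rfl i

theorem content_zero : content R (0 : K[X]) = ⊥ :=
  le_bot_iff.1 (content_le.2 fun i => by simp)

theorem content_add_le (p q : K[X]) : content R (p + q) ≤ content R p ⊔ content R q :=
  content_le.2 fun i => by
    rw [coeff_add]
    exact Submodule.add_mem_sup (coeff_mem_content p i) (coeff_mem_content q i)

theorem content_sub_le (p q : K[X]) : content R (p - q) ≤ content R p ⊔ content R q :=
  content_le.2 fun i => by
    rw [coeff_sub]
    exact sub_mem (Submodule.mem_sup_left (coeff_mem_content p i))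
      (Submodule.mem_sup_right (coeff_mem_content q i))

theorem content_mul_le (p q : K[X]) : content R (p * q) ≤ content R p * content R q :=
  content_le.2 fun i => by
    rw [coeff_mul]
    exact sum_mem fun x _ =>
      Submodule.mul_mem_mul (coeff_mem_content p x.1) (coeff_mem_content q x.2)

theorem content_monomial (n : ℕ) (a : K) : content R (monomial n a) = Submodule.span R {a} := by
  refine le_antisymm (content_le.2 fun i => ?_) ?_
  · rw [coeff_monomial]
    split_ifs
    · exact Submodule.mem_span_singleton_self a
    · exact zero_mem _
  · rw [Submodule.span_singleton_le_iff_mem]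
    simpa using coeff_mem_content (R := R) (monomial n a) n

theorem content_C (a : K) : content R (C a) = Submodule.span R {a} :=
  content_monomial 0 a

theorem content_C_mul (a : K) (p : K[X]) :
    content R (C a * p) = Submodule.span R {a} * content R p := by
  refine le_antisymm ((content_mul_le _ _).trans (by rw [content_C])) ?_
  rw [content, content, Submodule.span_mul_span, Submodule.span_le]
  rintro _ ⟨x, rfl, _, ⟨i, rfl⟩, rfl⟩
  have := coeff_mem_content (R := R) (C x * p) i
  rwa [coeff_C_mul] at this

theorem leadingCoeff_mem_content (p : K[X]) : p.leadingCoeff ∈ content R p :=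
  coeff_mem_content p _

theorem content_eraseLead_le (p : K[X]) : content R p.eraseLead ≤ content R p :=
  content_le.2 fun i => by
    rw [eraseLead_coeff]
    split_ifs
    · exact zero_mem _
    · exact coeff_mem_content p i

theorem content_le_eraseLead_sup (p : K[X]) :
    content R p ≤ content R p.eraseLead ⊔ Submodule.span R {p.leadingCoeff} := by
  conv_lhs => rw [← p.eraseLead_add_monomial_natDegree_leadingCoeff]
  refine (content_add_le _ _).trans (sup_le_sup le_rfl ?_)
  rw [content_monomial]

/-- Separates the pure power of `I` from the terms divisible by `a`; below, `a` is the leading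
coefficient and `I` the content of what remains. -/
theorem sup_span_pow_succ_le (I : Submodule R K) (a : K) (n : ℕ) :
    (I ⊔ Submodule.span R {a}) ^ (n + 1) ≤
      I ^ (n + 1) ⊔ Submodule.span R {a} * (I ⊔ Submodule.span R {a}) ^ n := by
  induction n with
  | zero => simp
  | succ n ih =>
    calc (I ⊔ Submodule.span R {a}) ^ (n + 1 + 1)
        = (I ⊔ Submodule.span R {a}) ^ (n + 1) * I ⊔
          (I ⊔ Submodule.span R {a}) ^ (n + 1) * Submodule.span R {a} := by
          rw [pow_succ _ (n + 1), Submodule.mul_sup]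
      _ ≤ _ := by
        refine sup_le ?_ ?_
        · refine (mul_le_mul' ih le_rfl).trans ?_
          rw [Submodule.sup_mul, ← pow_succ, mul_assoc]
          refine sup_le_sup le_rfl (mul_le_mul' le_rfl ?_)
          rw [pow_succ]
          exact mul_le_mul' le_rfl le_sup_left
        · rw [mul_comm]
          exact le_sup_right

/-- A weak form of the Dedekind–Mertens lemma, with an unspecified exponent. -/
theorem exists_content_pow_mul_le (f g : K[X]) :
    ∃ n : ℕ, content R f ^ (n + 1) * content R g ≤ content R f ^ n * content R (f * g) := by
  -- Induction on the total number of terms, so that erasing the leading term of either factor is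
  -- allowed.
  obtain ⟨k, hk⟩ : ∃ k, f.support.card + g.support.card ≤ k := ⟨_, le_rfl⟩
  induction k generalizing f g with
  | zero =>
    have : f = 0 := by
      rw [← card_support_eq_zero]
      omega
    exact ⟨0, by simp [this, content_zero]⟩
  | succ k ih =>
    by_cases hf : f = 0
    · exact ⟨0, by simp [hf, content_zero]⟩
    by_cases hg : g = 0
    · exact ⟨0, by simp [hg, content_zero]⟩
    have hf' : f.eraseLead.support.card < f.support.card := eraseLead_support_card_lt hf
    have hg' : g.eraseLead.support.card < g.support.card := eraseLead_support_card_lt hg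
    set a := f.leadingCoeff with ha
    set b := g.leadingCoeff with hb
    set I := content R f with hI
    set H := content R g with hH
    set L := content R (f * g) with hL
    set A : Submodule R K := Submodule.span R {a} with hA
    have hAI : A ≤ I := by
      rw [hA, Submodule.span_singleton_le_iff_mem]
      exact leadingCoeff_mem_content f
    have hab : Submodule.span R {a * b} ≤ L := by
      rw [Submodule.span_singleton_le_iff_mem, ha, hb, ← leadingCoeff_mul]
      exact leadingCoeff_mem_content _
    obtain ⟨n, hn⟩ := ih f g.eraseLead (by omega)
    obtain ⟨m, hm⟩ := ih f.eraseLead g (by omega)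
    -- `a` times the claim
    have h1 : A * (I ^ (n + 1) * H) ≤ I ^ (n + 1) * L := by
      have h2 : A * content R (f * g.eraseLead) ≤ I * L := by
        rw [hA, ← content_C_mul]
        have e : C a * (f * g.eraseLead) =
            C a * (f * g) - monomial g.natDegree (a * b) * f := by
          have := g.eraseLead_add_monomial_natDegree_leadingCoeff
          rw [← hb] at this
          rw [← C_mul_monomial]
          linear_combination C a * f * this
        rw [e]
        refine (content_sub_le _ _).trans (sup_le ?_ ?_)
        · rw [content_C_mul]
          exact mul_le_mul' hAI le_rfl
        · refine (content_mul_le _ _).trans ?_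
          rw [content_monomial, mul_comm]
          exact mul_le_mul' le_rfl hab
      calc A * (I ^ (n + 1) * H)
          ≤ A * (I ^ (n + 1) * (content R g.eraseLead ⊔ Submodule.span R {b})) := by
            gcongr
            exact content_le_eraseLead_sup g
        _ = A * (I ^ (n + 1) * content R g.eraseLead) ⊔
            I ^ (n + 1) * Submodule.span R {a * b} := by
            rw [Submodule.mul_sup, Submodule.mul_sup, ← Set.singleton_mul_singleton,
              ← Submodule.span_mul_span, ← hA]
            congr 1
            ring
        _ ≤ I ^ (n + 1) * L := by
            refine sup_le ?_ (mul_le_mul' le_rfl hab)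
            calc A * (I ^ (n + 1) * content R g.eraseLead)
                ≤ A * (I ^ n * content R (f * g.eraseLead)) := mul_le_mul' le_rfl hn
              _ = I ^ n * (A * content R (f * g.eraseLead)) := by ring
              _ ≤ I ^ n * (I * L) := mul_le_mul' le_rfl h2
              _ = I ^ (n + 1) * L := by ring
    have h3 : content R (f.eraseLead * g) ≤ L ⊔ A * H := by
      have e : f.eraseLead * g = f * g - monomial f.natDegree a * g := by
        have := f.eraseLead_add_monomial_natDegree_leadingCoeff
        rw [← ha] at this
        linear_combination g * this
      rw [e]
      refine (content_sub_le _ _).trans (sup_le_sup le_rfl ?_)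
      exact (content_mul_le _ _).trans (by rw [content_monomial])
    have h4 : I ^ (m + 1) * H ≤ I ^ m * L ⊔ A * (I ^ m * H) := by
      have hI' : I ≤ content R f.eraseLead ⊔ A := content_le_eraseLead_sup f
      have hI'' : content R f.eraseLead ⊔ A ≤ I := sup_le (content_eraseLead_le f) hAI
      have e : I = content R f.eraseLead ⊔ A := le_antisymm hI' hI''
      have h5 : I ^ (m + 1) ≤ content R f.eraseLead ^ (m + 1) ⊔ A * I ^ m := by
        have := sup_span_pow_succ_le (content R f.eraseLead) a m
        rwa [← hA, ← e] at this
      calc I ^ (m + 1) * H ≤ (content R f.eraseLead ^ (m + 1) ⊔ A * I ^ m) * H :=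
            mul_le_mul' h5 le_rfl
        _ = content R f.eraseLead ^ (m + 1) * H ⊔ A * (I ^ m * H) := by
            rw [Submodule.sup_mul, mul_assoc A]
        _ ≤ I ^ m * L ⊔ A * (I ^ m * H) := by
            refine sup_le ?_ le_sup_right
            calc content R f.eraseLead ^ (m + 1) * H
                ≤ content R f.eraseLead ^ m * content R (f.eraseLead * g) := hm
              _ ≤ I ^ m * (L ⊔ A * H) := by
                  gcongr
                  exact content_eraseLead_le f
              _ = I ^ m * L ⊔ A * (I ^ m * H) := by
                  rw [Submodule.mul_sup]
                  congr 1
                  ring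
    -- `h4` leaves only an error carrying the factor `a`, which `h1` absorbs; their exponents add
    -- up.
    refine ⟨m + n + 1, ?_⟩
    calc I ^ (m + n + 1 + 1) * H = I ^ (n + 1) * (I ^ (m + 1) * H) := by ring
      _ ≤ I ^ (n + 1) * (I ^ m * L ⊔ A * (I ^ m * H)) := mul_le_mul' le_rfl h4
      _ = I ^ (m + n + 1) * L ⊔ I ^ m * (A * (I ^ (n + 1) * H)) := by
          rw [Submodule.mul_sup]
          congr 1 <;> ring
      _ ≤ I ^ (m + n + 1) * L := by
          refine sup_le le_rfl ?_
          calc I ^ m * (A * (I ^ (n + 1) * H)) ≤ I ^ m * (I ^ (n + 1) * L) :=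
                mul_le_mul' le_rfl h1
            _ = I ^ (m + n + 1) * L := by ring

end Content

/-! ### A length bound for ranks at a height one prime. -/

section Bound

open scoped Pointwise

/-- Over a one-dimensional Noetherian local domain, the length of `S / aS` bounds the size of
families in an ideal `J` which are linearly independent modulo `𝔪 J`. -/
theorem card_le_ord_of_independent {S : Type*} [CommRing S] [IsDomain S] [IsNoetherianRing S]
    [IsLocalRing S] [Ring.KrullDimLE 1 S] {a : S} (ha : a ∈ IsLocalRing.maximalIdeal S)
    (ha0 : a ≠ 0) {J : Ideal S} (hJ : J ≠ ⊥) {d : ℕ} {u : Fin d → S} (hu : ∀ j, u j ∈ J)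
    (h : ∀ c : Fin d → S, ∑ j, c j * u j ∈ IsLocalRing.maximalIdeal S * J →
      ∀ j, c j ∈ IsLocalRing.maximalIdeal S) :
    (d : ℕ∞) ≤ Ring.ord S a := by
  classical
  set m := IsLocalRing.maximalIdeal S with hm
  obtain ⟨b, hb, hb0⟩ := (Submodule.ne_bot_iff J).1 hJ
  have hfin : Module.length S (S ⧸ J) ≠ ⊤ := by
    have h1 : Module.length S (S ⧸ Ideal.span {b}) ≠ ⊤ := Module.length_ne_top_iff.2
      (isFiniteLength_quotient_span_singleton S (mem_nonZeroDivisors_of_ne_zero hb0))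
    have hle : Ideal.span {b} ≤ J := (Ideal.span_singleton_le_iff_mem J).2 hb
    exact ne_top_of_le_ne_top h1
      (Module.length_le_of_surjective (Submodule.factor hle) (Submodule.factor_surjective hle))
  -- From `0 → S/J → S/aJ → S/aS → 0`. Compared with `0 → J/aJ → S/aJ → S/J → 0` below, it shows
  -- that `J/aJ` has the length of `S/aS`, because `S/J` has finite length.
  have hlen : Module.length S (S ⧸ (a • J)) = Module.length S (S ⧸ J) + Ring.ord S a :=
    Module.length_eq_add_of_exact (Ideal.mulQuot a J) (Ideal.quotOfMul a J)
      (Ideal.mulQuot_injective J (mem_nonZeroDivisors_of_ne_zero ha0))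
      (Ideal.quotOfMul_surjective J) (Ideal.exact_mulQuot_quotOfMul J)
  have haJ : a • J ≤ J := Submodule.smul_le_self_of_tower a J
  have haJ' : a • J ≤ m * J := by
    rintro _ ⟨x, hx, rfl⟩
    exact Ideal.mul_mem_mul ha hx
  let q : (S ⧸ (a • J)) →ₗ[S] (S ⧸ J) := Submodule.factor haJ
  have hlen' : Module.length S (S ⧸ (a • J)) =
      Module.length S (LinearMap.ker q) + Module.length S (S ⧸ J) :=
    Module.length_eq_add_of_exact (LinearMap.ker q).subtype q (Submodule.subtype_injective _)
      (Submodule.factor_surjective haJ) (LinearMap.exact_subtype_ker_map q)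
  let φ : (Fin d → S) →ₗ[S] (S ⧸ (a • J)) :=
    (Submodule.mkQ (a • J)).comp (Fintype.linearCombination S u)
  have hφ : ∀ c, φ c = Submodule.Quotient.mk (∑ j, c j * u j) := fun c => by
    simp [φ, Fintype.linearCombination_apply]
  have hrange : LinearMap.range φ ≤ LinearMap.ker q := by
    rintro _ ⟨c, rfl⟩
    rw [LinearMap.mem_ker, hφ]
    have : ∑ j, c j * u j ∈ J := sum_mem fun j _ => J.mul_mem_left _ (hu j)
    exact (Submodule.Quotient.mk_eq_zero J).2 this
  let π : (Fin d → S) →ₗ[S] (Fin d → S ⧸ m) := LinearMap.compLeft (Submodule.mkQ m) (Fin d)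
  have hπ : Function.Surjective π := fun y => by
    choose c hc using fun j => Submodule.mkQ_surjective m (y j)
    exact ⟨c, funext hc⟩
  have hker : LinearMap.ker φ ≤ LinearMap.ker π := by
    intro c hc
    rw [LinearMap.mem_ker, hφ, Submodule.Quotient.mk_eq_zero] at hc
    rw [LinearMap.mem_ker]
    funext j
    exact (Submodule.Quotient.mk_eq_zero m).2 (h c (haJ' hc) j)
  -- Since `aJ ⊆ 𝔪J`, independence makes the submodule of `J/aJ` generated by the `u j` surject onto
  -- `(S/𝔪)ᵈ`, of length `d`.
  have hd : (d : ℕ∞) ≤ Module.length S (LinearMap.range φ) := by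
    have h1 : Module.length S (Fin d → S ⧸ m) ≤
        Module.length S ((Fin d → S) ⧸ LinearMap.ker φ) :=
      Module.length_le_of_surjective ((LinearMap.ker φ).liftQ π hker) fun y => by
        obtain ⟨c, rfl⟩ := hπ y
        exact ⟨Submodule.Quotient.mk c, rfl⟩
    have : IsSimpleModule S (S ⧸ m) :=
      isSimpleModule_iff_isCoatom.2 (IsLocalRing.maximalIdeal.isMaximal S).out
    rw [Module.length_pi, Module.length_eq_one] at h1
    rw [← (φ.quotKerEquivRange).length_eq]
    simpa using h1
  have hfinal : (d : ℕ∞) + Module.length S (S ⧸ J) ≤ Ring.ord S a + Module.length S (S ⧸ J) := by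
    rw [add_comm (Ring.ord S a), ← hlen, hlen']
    gcongr
    exact hd.trans (Module.length_le_of_injective (Submodule.inclusion hrange)
      (Submodule.inclusion_injective hrange))
  exact (ENat.add_le_add_iff_right hfin).1 hfinal

/-- The rank of `J / P J` at a height one prime `P` is bounded independently of `J`. -/
theorem exists_card_le_of_independent {R : Type*} [CommRing R] [IsDomain R] [IsNoetherianRing R]
    (P : Ideal R) [hP : P.IsPrime] (hP0 : P ≠ ⊥)
    (hP1 : ∀ Q : Ideal R, Q.IsPrime → Q ≠ ⊥ → Q ≤ P → Q = P) :
    ∃ e : ℕ, ∀ J : Ideal R, J ≠ ⊥ → ∀ (d : ℕ) (u : Fin d → R), (∀ j, u j ∈ J) →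
      (∀ (c : Fin d → R), ∀ s ∉ P, s * ∑ j, c j * u j ∈ P * J → ∀ j, c j ∈ P) → d ≤ e := by
  obtain ⟨a, ha, ha0⟩ := (Submodule.ne_bot_iff P).1 hP0
  let S := Localization.AtPrime P
  have : IsDomain S := IsLocalization.isDomain_localization P.primeCompl_le_nonZeroDivisors
  have : IsNoetherianRing S := IsLocalization.isNoetherianRing P.primeCompl S inferInstance
  have hinj : Function.Injective (algebraMap R S) :=
    IsLocalization.injective S P.primeCompl_le_nonZeroDivisors
  have haS : algebraMap R S a ≠ 0 := fun h => ha0 (hinj (by rw [h, map_zero]))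
  have hmP : ∀ x : R, algebraMap R S x ∈ IsLocalRing.maximalIdeal S ↔ x ∈ P := fun x =>
    IsLocalization.AtPrime.to_map_mem_maximal_iff S P x
  have hmap : IsLocalRing.maximalIdeal S = P.map (algebraMap R S) :=
    (Localization.AtPrime.map_eq_maximalIdeal (I := P)).symm
  have : Ring.KrullDimLE 1 S := by
    refine Ring.krullDimLE_one_iff_of_noZeroDivisors.2 fun Q hQ0 hQ => ?_
    have hQm : Q.comap (algebraMap R S) ≤ P := fun x hx =>
      (hmP x).1 (IsLocalRing.le_maximalIdeal hQ.ne_top hx)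
    have hQmap : (Q.comap (algebraMap R S)).map (algebraMap R S) = Q :=
      IsLocalization.map_under P.primeCompl S Q
    have hQP : Q.comap (algebraMap R S) = P := hP1 _ (hQ.comap _)
      (fun h => hQ0 (by rw [← hQmap, h, Ideal.map_bot])) hQm
    rw [← hQmap, hQP, ← hmap]
    exact IsLocalRing.maximalIdeal.isMaximal S
  have htop : Ring.ord S (algebraMap R S a) ≠ ⊤ :=
    Ring.ord_ne_top (mem_nonZeroDivisors_of_ne_zero haS)
  -- The bound is the length of `R_P / a R_P`, for one nonzero `a ∈ P` fixed before `J`.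
  refine ⟨(Ring.ord S (algebraMap R S a)).toNat, fun J hJ d u hu h => ?_⟩
  rw [← Nat.cast_le (α := ℕ∞), ENat.natCast_toNat htop]
  refine card_le_ord_of_independent ((hmP a).2 ha) haS (J := J.map (algebraMap R S))
    (u := fun j => algebraMap R S (u j)) ?_ (fun j => Ideal.mem_map_of_mem _ (hu j)) ?_
  · rwa [Ne, Ideal.map_eq_bot_iff_of_injective hinj]
  · intro c hc
    obtain ⟨t, ht⟩ := IsLocalization.exist_integer_multiples_of_finite P.primeCompl c
    choose c' hc' using ht
    rw [hmap, ← Ideal.map_mul, IsLocalization.mem_map_algebraMap_iff P.primeCompl] at hc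
    obtain ⟨⟨⟨y, hy⟩, s⟩, hys⟩ := hc
    have key : ∀ j, c' j ∈ P := by
      refine h c' s s.2 ?_
      have : s * ∑ j, c' j * u j = t * y := by
        apply hinj
        rw [map_mul, map_mul, ← hys, map_sum]
        simp only [map_mul, hc', Finset.sum_mul, Finset.mul_sum, Algebra.smul_def]
        refine Finset.sum_congr rfl fun j _ => ?_
        ring
      rw [this]
      exact Ideal.mul_mem_left _ _ hy
    intro j
    have h1 := (hmP (c' j)).2 (key j)
    rw [hc', Algebra.smul_def] at h1
    refine ((IsLocalRing.maximalIdeal.isMaximal S).isPrime.mem_or_mem h1).resolve_left ?_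
    rw [hmP]
    exact t.2

end Bound

open IsLocalization

/-! ### Irrelevant torsion in the fiber ring at `P`. -/

section Negligible

variable {R K : Type*} [CommRing R] [Field K] [Algebra R K]

theorem span_algebraMap_le_one (s : R) : Submodule.span R {algebraMap R K s} ≤ 1 := by
  rw [Submodule.span_singleton_le_iff_mem]
  exact Submodule.mem_one.2 ⟨s, rfl⟩

theorem coeSubmodule_le_one (P : Ideal R) : coeSubmodule K P ≤ 1 := by
  rintro _ ⟨x, -, rfl⟩
  exact Submodule.mem_one.2 ⟨x, rfl⟩

theorem content_map_le_one (c : R[X]) : content R (c.map (algebraMap R K)) ≤ 1 :=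
  content_le.2 fun i => by
    rw [coeff_map]
    exact Submodule.mem_one.2 ⟨_, rfl⟩

theorem content_map_mul_le (c : R[X]) (p : K[X]) :
    content R (c.map (algebraMap R K) * p) ≤ content R p :=
  (content_mul_le _ _).trans ((mul_le_mul' (content_map_le_one c) le_rfl).trans_eq (one_mul _))

theorem content_map_le_coeSubmodule {P : Ideal R} {c : R[X]}
    (hc : c.map (Ideal.Quotient.mk P) = 0) :
    content R (c.map (algebraMap R K)) ≤ coeSubmodule K P :=
  content_le.2 fun i => by
    rw [coeff_map]
    refine mem_coeSubmodule K P |>.2 ⟨_, ?_, rfl⟩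
    have := congrArg (fun q => q.coeff i) hc
    rwa [coeff_map, coeff_zero, Ideal.Quotient.eq_zero_iff_mem] at this

/-- `J`, thought of as sitting in degree `m` of the fiber ring `⨁ Iᵐ / P Iᵐ` localized at `P`,
is torsion with respect to the irrelevant ideal. -/
def Negligible (P : Ideal R) (I : Submodule R K) (m : ℕ) (J : Submodule R K) : Prop :=
  ∃ N : ℕ, ∃ s ∉ P, Submodule.span R {algebraMap R K s} * J * I ^ N ≤ coeSubmodule K P * I ^ (m + N)

variable {P : Ideal R} {I : Submodule R K} {m : ℕ} {J L : Submodule R K}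

theorem Negligible.mono (h : Negligible P I m L) (hJ : J ≤ L) : Negligible P I m J := by
  obtain ⟨N, s, hs, h⟩ := h
  exact ⟨N, s, hs, (mul_le_mul' (mul_le_mul' le_rfl hJ) le_rfl).trans h⟩

theorem negligible_coeSubmodule_mul (hP : P ≠ ⊤) (hJ : J ≤ I ^ m) :
    Negligible P I m (coeSubmodule K P * J) := by
  refine ⟨0, 1, (Ideal.ne_top_iff_one P).1 hP, ?_⟩
  rw [map_one, ← Submodule.one_eq_span, one_mul, pow_zero, mul_one, add_zero]
  exact mul_le_mul' le_rfl hJ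

theorem negligible_bot (hP : P ≠ ⊤) : Negligible P I m ⊥ :=
  (negligible_coeSubmodule_mul hP (bot_le : ⊥ ≤ I ^ m)).mono bot_le

theorem Negligible.mul (h : Negligible P I m J) {k : ℕ} (hL : L ≤ I ^ k) :
    Negligible P I (m + k) (J * L) := by
  obtain ⟨N, s, hs, h⟩ := h
  refine ⟨N, s, hs, ?_⟩
  calc _ = Submodule.span R {algebraMap R K s} * J * I ^ N * L := by ring
    _ ≤ coeSubmodule K P * I ^ (m + N) * I ^ k := mul_le_mul' h hL
    _ = _ := by ring

/-- The exponent `N` in the definition is free, so `k` is absorbed into it: modulo negligible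
elements no irrelevant torsion is left. -/
theorem negligible_of_mul_pow {k : ℕ} (h : Negligible P I (m + k) (J * I ^ k)) :
    Negligible P I m J := by
  obtain ⟨N, s, hs, h⟩ := h
  refine ⟨k + N, s, hs, ?_⟩
  calc _ = Submodule.span R {algebraMap R K s} * (J * I ^ k) * I ^ N := by ring
    _ ≤ _ := h
    _ = _ := by rw [add_assoc]

/-- Injectivity of multiplication by the generic element `f`. Dedekind–Mertens bounds `Iⁿ⁺¹` times
the content of `h` by `Iⁿ` times that of `f h`, and the power of `I` cancels. -/
theorem negligible_content_of_mul {f h : K[X]} (hf : content R f = I)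
    (hfh : Negligible P I (m + 1) (content R (f * h))) : Negligible P I m (content R h) := by
  obtain ⟨n, hn⟩ := exists_content_pow_mul_le (R := R) f h
  rw [hf] at hn
  have h1 := (hfh.mul (L := I ^ n) le_rfl).mono (hn.trans_eq (mul_comm _ _))
  rw [mul_comm, add_assoc, add_comm 1 n] at h1
  exact negligible_of_mul_pow h1

variable [P.IsPrime]

theorem Negligible.sup (hJ : Negligible P I m J) (hL : Negligible P I m L) :
    Negligible P I m (J ⊔ L) := by
  obtain ⟨N, s, hs, h⟩ := hJ
  obtain ⟨N', s', hs', h'⟩ := hL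
  refine ⟨N + N', s * s', ‹P.IsPrime›.mul_notMem hs hs', ?_⟩
  rw [map_mul, ← Set.singleton_mul_singleton, ← Submodule.span_mul_span, Submodule.mul_sup,
    Submodule.sup_mul]
  refine sup_le ?_ ?_
  · calc _ = Submodule.span R {algebraMap R K s'} *
          (Submodule.span R {algebraMap R K s} * J * I ^ N) * I ^ N' := by ring
      _ ≤ 1 * (coeSubmodule K P * I ^ (m + N)) * I ^ N' :=
        mul_le_mul' (mul_le_mul' (span_algebraMap_le_one s') h) le_rfl
      _ = _ := by ring
  · calc _ = Submodule.span R {algebraMap R K s} *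
          (Submodule.span R {algebraMap R K s'} * L * I ^ N') * I ^ N := by ring
      _ ≤ 1 * (coeSubmodule K P * I ^ (m + N')) * I ^ N :=
        mul_le_mul' (mul_le_mul' (span_algebraMap_le_one s) h') le_rfl
      _ = _ := by ring

theorem negligible_content_add {p q : K[X]} (hp : Negligible P I m (content R p))
    (hq : Negligible P I m (content R q)) : Negligible P I m (content R (p + q)) :=
  (hp.sup hq).mono (content_add_le p q)

theorem negligible_content_sub {p q : K[X]} (hp : Negligible P I m (content R p))
    (hq : Negligible P I m (content R q)) : Negligible P I m (content R (p - q)) :=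
  (hp.sup hq).mono (content_sub_le p q)

theorem negligible_content_sum {ι : Type*} (t : Finset ι) (p : ι → K[X])
    (h : ∀ i ∈ t, Negligible P I m (content R (p i))) :
    Negligible P I m (content R (∑ i ∈ t, p i)) := by
  refine Finset.sum_induction p (fun q => Negligible P I m (content R q))
    (fun _ _ => negligible_content_add) ?_ h
  rw [content_zero]
  exact negligible_bot ‹P.IsPrime›.ne_top

omit [P.IsPrime] in
theorem negligible_content_map_mul {p : K[X]} (hp : Negligible P I m (content R p)) (c : R[X]) :
    Negligible P I m (content R (c.map (algebraMap R K) * p)) :=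
  hp.mono (content_map_mul_le c p)

theorem negligible_content_of_map_mul_C {c : R[X]} (hc : c.map (Ideal.Quotient.mk P) = 0) {v : K}
    (hv : v ∈ I ^ m) : Negligible P I m (content R (c.map (algebraMap R K) * C v)) := by
  refine (negligible_coeSubmodule_mul ‹P.IsPrime›.ne_top
    ((Submodule.span_singleton_le_iff_mem v (I ^ m)).2 hv)).mono ((content_mul_le _ _).trans ?_)
  rw [content_C]
  exact mul_le_mul' (content_map_le_coeSubmodule hc) le_rfl

end Negligible

/-! ### Independent and generating families in the localized fiber. -/

section Families

variable {R K : Type*} [CommRing R] [Field K] [Algebra R K]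

/-- A family in `Iᵐ` that is linearly independent over the residue field at `P` modulo
negligible elements. -/
def Independent (P : Ideal R) (I : Submodule R K) (m : ℕ) {d : ℕ} (u : Fin d → K) : Prop :=
  (∀ j, u j ∈ I ^ m) ∧ ∀ c : Fin d → R,
    Negligible P I m (Submodule.span R {∑ j, c j • u j}) → ∀ j, c j ∈ P

/-- A family in `Iᵐ` that generates `Iᵐ` locally at `P` modulo negligible elements. -/
def Generates (P : Ideal R) (I : Submodule R K) (m : ℕ) {d : ℕ} (v : Fin d → K) : Prop :=
  (∀ j, v j ∈ I ^ m) ∧ ∀ w ∈ I ^ m, ∃ s ∉ P, ∃ c : Fin d → R,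
    Negligible P I m (Submodule.span R {s • w - ∑ j, c j • v j})

variable {P : Ideal R} [P.IsPrime] {I : Submodule R K} {m : ℕ}

/-- The exchange argument over the residue field: an element `w` that is not generated enlarges the
family. In a relation, a coefficient of `w` outside `P` would generate `w`, and one inside `P`
contributes only a negligible term. -/
theorem Independent.generates_or {d : ℕ} {u : Fin d → K} (hu : Independent P I m u) :
    Generates P I m u ∨ ∃ u' : Fin (d + 1) → K, Independent P I m u' := by
  by_cases h : Generates P I m u
  · exact Or.inl h
  right
  obtain ⟨w, hw, h⟩ : ∃ w ∈ I ^ m, ∀ s ∉ P, ∀ c : Fin d → R,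
      ¬ Negligible P I m (Submodule.span R {s • w - ∑ j, c j • u j}) := by
    by_contra! hcon
    exact h ⟨hu.1, hcon⟩
  refine ⟨Fin.cons w u, fun j => ?_, fun c hc => ?_⟩
  · induction j using Fin.cases with
    | zero => exact hw
    | succ j => exact hu.1 j
  · rw [Fin.sum_univ_succ] at hc
    simp only [Fin.cons_zero, Fin.cons_succ] at hc
    have h0 : c 0 ∈ P := by
      by_contra h0
      refine h (c 0) h0 (fun j => - c j.succ) ?_
      simpa [sub_eq_add_neg] using hc
    have h1 : Negligible P I m (Submodule.span R {∑ j, c (Fin.succ j) • u j}) := by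
      have h2 : Negligible P I m (Submodule.span R {c 0 • w}) := by
        refine (negligible_coeSubmodule_mul ‹P.IsPrime›.ne_top (le_refl (I ^ m))).mono ?_
        rw [Submodule.span_singleton_le_iff_mem, Algebra.smul_def]
        exact Submodule.mul_mem_mul ((mem_coeSubmodule K P).2 ⟨_, h0, rfl⟩) hw
      refine (hc.sup h2).mono ?_
      rw [Submodule.span_singleton_le_iff_mem]
      have := sub_mem (Submodule.mem_sup_left (T := Submodule.span R {c 0 • w})
        (Submodule.mem_span_singleton_self (R := R) (c 0 • w + ∑ j, c (Fin.succ j) • u j)))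
        (Submodule.mem_sup_right (Submodule.mem_span_singleton_self (R := R) (c 0 • w)))
      rwa [add_sub_cancel_left] at this
    intro j
    induction j using Fin.cases with
    | zero => exact h0
    | succ j => exact hu.2 _ h1 j

/-- Families are grown one element at a time; a generating family found early is padded with zeros
to have exactly `d` members, as the square matrix later requires. -/
theorem exists_generates_or_independent (P : Ideal R) [P.IsPrime] (I : Submodule R K) (m d : ℕ) :
    (∃ v : Fin d → K, Generates P I m v) ∨ ∃ u : Fin (d + 1) → K, Independent P I m u := by
  induction d with
  | zero =>
    have : Independent P I m (Fin.elim0 : Fin 0 → K) := ⟨fun j => j.elim0, fun _ _ j => j.elim0⟩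
    exact this.generates_or.imp_left fun h => ⟨_, h⟩
  | succ d ih =>
    rcases ih with ⟨v, hv⟩ | ⟨u, hu⟩
    · refine Or.inl ⟨Fin.cons 0 v, fun j => ?_, fun w hw => ?_⟩
      · induction j using Fin.cases with
        | zero => exact zero_mem _
        | succ j => exact hv.1 j
      · obtain ⟨s, hs, c, hc⟩ := hv.2 w hw
        refine ⟨s, hs, Fin.cons 0 c, ?_⟩
        simpa [Fin.sum_univ_succ] using hc
    · exact hu.generates_or.imp_left fun h => ⟨_, h⟩

theorem Generates.polynomial {d : ℕ} {v : Fin d → K} (hv : Generates P I m v) {p : K[X]}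
    (hp : content R p ≤ I ^ m) : ∃ s ∉ P, ∃ c : Fin d → R[X], Negligible P I m
      (content R (C (algebraMap R K s) * p - ∑ j, (c j).map (algebraMap R K) * C (v j))) := by
  rw [p.as_sum_support]
  refine Finset.sum_induction _ (fun p : K[X] => ∃ s ∉ P, ∃ c : Fin d → R[X], Negligible P I m
    (content R (C (algebraMap R K s) * p - ∑ j, (c j).map (algebraMap R K) * C (v j)))) ?_ ?_ ?_
  · rintro p q ⟨s, hs, c, hc⟩ ⟨t, ht, b, hb⟩
    refine ⟨s * t, ‹P.IsPrime›.mul_notMem hs ht, fun j => C t * c j + C s * b j, ?_⟩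
    convert negligible_content_add (negligible_content_map_mul hc (C t))
      (negligible_content_map_mul hb (C s)) using 2
    simp only [Polynomial.map_add, Polynomial.map_mul, Polynomial.map_C, map_mul, add_mul, mul_sub,
      Finset.sum_add_distrib, Finset.mul_sum, mul_add, mul_assoc]
    ring
  · refine ⟨1, (Ideal.ne_top_iff_one P).1 ‹P.IsPrime›.ne_top, 0, ?_⟩
    simpa [content_zero] using negligible_bot ‹P.IsPrime›.ne_top
  · intro i _
    obtain ⟨s, hs, c, hc⟩ := hv.2 _ (hp (coeff_mem_content p i))
    refine ⟨s, hs, fun j => monomial i (c j), ?_⟩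
    convert hc using 1
    rw [← content_monomial i]
    congr 1
    simp [Algebra.smul_def, map_sub, map_sum, monomial_mul_C, C_mul_monomial]

omit [P.IsPrime] in
theorem Independent.polynomial {d : ℕ} {u : Fin d → K} (hu : Independent P I m u)
    {c : Fin d → R[X]}
    (hc : Negligible P I m (content R (∑ j, (c j).map (algebraMap R K) * C (u j)))) (j : Fin d) :
    (c j).map (Ideal.Quotient.mk P) = 0 := by
  ext i
  rw [coeff_map, coeff_zero, Ideal.Quotient.eq_zero_iff_mem]
  refine hu.2 (fun j => (c j).coeff i) (hc.mono ?_) j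
  rw [Submodule.span_singleton_le_iff_mem]
  have := coeff_mem_content (R := R) (∑ j, (c j).map (algebraMap R K) * C (u j)) i
  simpa [finsetSum_coeff, coeff_mul_C, Algebra.smul_def] using this

end Families

/-! ### Surjectivity of multiplication by `f`, up to torsion. -/

section Reduction

variable {R K : Type*} [CommRing R] [Field K] [Algebra R K]

theorem exists_pow_ne_bot {I : Submodule R K} (hI : I ≠ ⊥) (m : ℕ) : ∃ x ∈ I ^ m, x ≠ 0 := by
  obtain ⟨x, hx, hx0⟩ := (Submodule.ne_bot_iff I).1 hI
  exact ⟨x ^ m, Submodule.pow_mem_pow I hx m, pow_ne_zero m hx0⟩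

/-- The denominator that moves `Iᵐ` into `R` varies with `m`, but the bound for ideals of `R` does
not depend on the ideal. -/
theorem exists_independent_card_le [IsDomain R] [IsNoetherianRing R] [IsFractionRing R K]
    {P : Ideal R} [P.IsPrime] (hP0 : P ≠ ⊥)
    (hP1 : ∀ Q : Ideal R, Q.IsPrime → Q ≠ ⊥ → Q ≤ P → Q = P) {I : Submodule R K} (hI0 : I ≠ ⊥)
    (hI : I.FG) :
    ∃ e : ℕ, ∀ (m d : ℕ) (u : Fin d → K), Independent P I m u → d ≤ e := by
  obtain ⟨e, he⟩ := exists_card_le_of_independent P hP0 hP1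
  refine ⟨e, fun m d u hu => ?_⟩
  have hinj : Function.Injective (algebraMap R K) := IsFractionRing.injective R K
  obtain ⟨b, hb, hbI⟩ := FractionalIdeal.isFractional_of_fg (S := R⁰) (hI.pow m)
  have hb0 : algebraMap R K b ≠ 0 := fun h =>
    nonZeroDivisors.ne_zero hb (hinj (by rw [h, map_zero]))
  set J : Ideal R := (Submodule.span R {algebraMap R K b} * I ^ m).comap (Algebra.linearMap R K)
    with hJ
  have hmem : ∀ x ∈ I ^ m, ∃ y ∈ J, algebraMap R K y = algebraMap R K b * x := by
    intro x hx
    obtain ⟨y, hy⟩ := hbI x hx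
    rw [Algebra.smul_def] at hy
    refine ⟨y, ?_, hy⟩
    rw [hJ, Submodule.mem_comap, Algebra.linearMap_apply, hy]
    exact Submodule.mul_mem_mul (Submodule.mem_span_singleton_self _) hx
  have hJle : coeSubmodule K J ≤ Submodule.span R {algebraMap R K b} * I ^ m :=
    Submodule.map_comap_le _ _
  choose u' hu'J hu' using fun j => hmem (u j) (hu.1 j)
  refine he J ?_ d u' hu'J fun c s hs hc => hu.2 c ?_
  · obtain ⟨x, hx, hx0⟩ := exists_pow_ne_bot hI0 m
    obtain ⟨y, hy, hyx⟩ := hmem x hx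
    refine (Submodule.ne_bot_iff J).2 ⟨y, hy, fun h => mul_ne_zero hb0 hx0 ?_⟩
    rw [← hyx, h, map_zero]
  -- Membership in `P Iᵐ` up to `s` is the case `N = 0` of negligibility.
  · refine ⟨0, s, hs, ?_⟩
    rw [pow_zero, mul_one, add_zero, Submodule.span_mul_span, Set.singleton_mul_singleton,
      Submodule.span_singleton_le_iff_mem]
    have h1 : algebraMap R K (s * ∑ j, c j * u' j) ∈
        coeSubmodule K P * (Submodule.span R {algebraMap R K b} * I ^ m) := by
      have h2 := (mem_coeSubmodule K (P * J)).2 ⟨_, hc, rfl⟩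
      rw [coeSubmodule_mul] at h2
      exact mul_le_mul' le_rfl hJle h2
    have h3 := Submodule.mul_mem_mul (Submodule.mem_span_singleton_self (algebraMap R K b)⁻¹) h1
    have e1 : Submodule.span R {(algebraMap R K b)⁻¹} *
        (coeSubmodule K P * (Submodule.span R {algebraMap R K b} * I ^ m)) =
        coeSubmodule K P * I ^ m := by
      calc _ = Submodule.span R {(algebraMap R K b)⁻¹} * Submodule.span R {algebraMap R K b} *
            (coeSubmodule K P * I ^ m) := by ring
        _ = _ := by rw [span_inv_mul hb0, one_mul]
    rw [e1] at h3
    convert h3 using 1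
    simp only [map_mul, map_sum, hu', Algebra.smul_def, Finset.mul_sum]
    refine Finset.sum_congr rfl fun j _ => ?_
    field_simp

/-- Up to a polynomial over `R` that is nonzero modulo `P`, the element `w` of `Iᵐ⁺¹` is a multiple
of `f` modulo the elements that `Iᴺ` multiplies into `P Iᵐ⁺¹⁺ᴺ`. -/
def Reduces (P : Ideal R) (I : Submodule R K) (f : K[X]) (m N : ℕ) (w : K) : Prop :=
  ∃ g : R[X], g.map (Ideal.Quotient.mk P) ≠ 0 ∧ ∃ h : K[X], content R h ≤ I ^ m ∧
    content R (g.map (algebraMap R K) * C w - f * h) * I ^ N ≤ coeSubmodule K P * I ^ (m + 1 + N)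

variable {P : Ideal R} [P.IsPrime] {I : Submodule R K} {f : K[X]} {m N : ℕ}

theorem Reduces.add {w z : K} (hw : Reduces P I f m N w) (hz : Reduces P I f m N z) :
    Reduces P I f m N (w + z) := by
  obtain ⟨g, hg, h, hh, hr⟩ := hw
  obtain ⟨g', hg', h', hh', hr'⟩ := hz
  refine ⟨g * g', by rw [Polynomial.map_mul]; exact mul_ne_zero hg hg',
    g'.map (algebraMap R K) * h + g.map (algebraMap R K) * h',
    (content_add_le _ _).trans (sup_le ((content_map_mul_le _ _).trans hh)
      ((content_map_mul_le _ _).trans hh')), ?_⟩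
  have e : (g * g').map (algebraMap R K) * C (w + z) -
      f * (g'.map (algebraMap R K) * h + g.map (algebraMap R K) * h') =
      g'.map (algebraMap R K) * (g.map (algebraMap R K) * C w - f * h) +
        g.map (algebraMap R K) * (g'.map (algebraMap R K) * C z - f * h') := by
    rw [Polynomial.map_mul, C_add]
    ring
  rw [e]
  refine (mul_le_mul' (content_add_le _ _) le_rfl).trans ?_
  rw [Submodule.sup_mul]
  exact sup_le ((mul_le_mul' (content_map_mul_le _ _) le_rfl).trans hr)
    ((mul_le_mul' (content_map_mul_le _ _) le_rfl).trans hr')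

omit [P.IsPrime] in
theorem Reduces.smul {w : K} (hw : Reduces P I f m N w) (r : R) : Reduces P I f m N (r • w) := by
  obtain ⟨g, hg, h, hh, hr⟩ := hw
  refine ⟨g, hg, (C r).map (algebraMap R K) * h, (content_map_mul_le _ _).trans hh, ?_⟩
  have e : g.map (algebraMap R K) * C (r • w) - f * ((C r).map (algebraMap R K) * h) =
      (C r).map (algebraMap R K) * (g.map (algebraMap R K) * C w - f * h) := by
    rw [Algebra.smul_def, C_mul, Polynomial.map_C]
    ring
  rw [e]
  exact (mul_le_mul' (content_map_mul_le _ _) le_rfl).trans hr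

omit [P.IsPrime] in
theorem Reduces.mono {w : K} {N' : ℕ} (hN : N ≤ N') (hw : Reduces P I f m N w) :
    Reduces P I f m N' w := by
  obtain ⟨k, rfl⟩ := Nat.exists_eq_add_of_le hN
  obtain ⟨g, hg, h, hh, hr⟩ := hw
  refine ⟨g, hg, h, hh, ?_⟩
  rw [pow_add, ← mul_assoc, ← add_assoc, pow_add I (m + 1 + N), ← mul_assoc]
  exact mul_le_mul' hr le_rfl

/-- An exponent may always be enlarged, so finitely many generators share one. -/
theorem exists_forall_reduces {J : Submodule R K} (hJ : J.FG)
    (h : ∀ w ∈ J, ∃ N, Reduces P I f m N w) : ∃ N, ∀ w ∈ J, Reduces P I f m N w := by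
  induction J, hJ using Submodule.fg_induction with
  | singleton x =>
    obtain ⟨N, hN⟩ := h x (Submodule.mem_span_singleton_self x)
    refine ⟨N, fun w hw => ?_⟩
    obtain ⟨r, rfl⟩ := Submodule.mem_span_singleton.1 hw
    exact hN.smul r
  | sup J L _ _ hJ hL =>
    obtain ⟨N, hN⟩ := hJ fun w hw => h w (Submodule.mem_sup_left hw)
    obtain ⟨N', hN'⟩ := hL fun w hw => h w (Submodule.mem_sup_right hw)
    refine ⟨max N N', fun w hw => ?_⟩
    obtain ⟨y, hy, z, hz, rfl⟩ := Submodule.mem_sup.1 hw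
    exact ((hN y hy).mono (le_max_left _ _)).add ((hN' z hz).mono (le_max_right _ _))

omit [P.IsPrime] in
-- Trades the exponent for degree: `N` degrees higher, the torsion error is a genuine element of `P
-- I^(m+N+1)`, as Nakayama requires.
theorem Reduces.mul {y z : K} (hy : Reduces P I f m N y) (hz : z ∈ I ^ N) :
    Reduces P I f (m + N) 0 (y * z) := by
  obtain ⟨g, hg, h, hh, hr⟩ := hy
  have hz' : Submodule.span R {z} ≤ I ^ N := (Submodule.span_singleton_le_iff_mem _ _).2 hz
  refine ⟨g, hg, h * C z, ?_, ?_⟩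
  · refine (content_mul_le _ _).trans ?_
    rw [content_C, pow_add]
    exact mul_le_mul' hh hz'
  · have e : g.map (algebraMap R K) * C (y * z) - f * (h * C z) =
        (g.map (algebraMap R K) * C y - f * h) * C z := by
      rw [C_mul]
      ring
    rw [e, pow_zero, mul_one]
    refine (content_mul_le _ _).trans ?_
    rw [content_C]
    refine (mul_le_mul' le_rfl hz').trans (hr.trans_eq ?_)
    congr 2
    ring

theorem reduces_of_negligible {g : R[X]} (hg : g.map (Ideal.Quotient.mk P) ≠ 0) {h : K[X]}
    (hh : content R h ≤ I ^ m) {w : K}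
    (hr : Negligible P I (m + 1) (content R (g.map (algebraMap R K) * C w - f * h))) :
    ∃ N, Reduces P I f m N w := by
  obtain ⟨N, s, hs, hr⟩ := hr
  refine ⟨N, C s * g, ?_, (C s).map (algebraMap R K) * h, (content_map_mul_le _ _).trans hh, ?_⟩
  · rw [Polynomial.map_mul, Polynomial.map_C]
    refine mul_ne_zero ?_ hg
    rwa [Ne, C_eq_zero, Ideal.Quotient.eq_zero_iff_mem]
  · convert hr using 2
    rw [← content_C_mul, Polynomial.map_mul, Polynomial.map_C]
    congr 1
    ring

/-- If an independent family in `Iᵐ` is as large as a generating one in `Iᵐ⁺¹`, multiplication by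
a polynomial with content `I` is generically onto, up to negligible elements. -/
theorem exists_reduces_of_independent {d : ℕ} {u v : Fin d → K} (hf : content R f = I)
    (hu : Independent P I m u) (hv : Generates P I (m + 1) v) {w : K} (hw : w ∈ I ^ (m + 1)) :
    ∃ N, Reduces P I f m N w := by
  have hcol : ∀ j, content R (f * C (u j)) ≤ I ^ (m + 1) := fun j => by
    refine (content_mul_le _ _).trans ?_
    rw [content_C, hf, pow_succ']
    exact mul_le_mul' le_rfl ((Submodule.span_singleton_le_iff_mem _ _).2 (hu.1 j))
  choose s hs M hM using fun j => hv.polynomial (hcol j)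
  set q : Fin d → K[X] := fun j => C (algebraMap R K (s j)) * (f * C (u j)) -
    ∑ i, (M j i).map (algebraMap R K) * C (v i) with hq
  have hMq : ∀ j, ∑ i, (M j i).map (algebraMap R K) * C (v i) =
      C (algebraMap R K (s j)) * (f * C (u j)) - q j := fun j => by simp [hq]
  -- the matrix of multiplication by `f` is invertible modulo `P`
  have hdet : (Matrix.det (Matrix.of M)).map (Ideal.Quotient.mk P) ≠ 0 := by
    intro hdet
    have h1 : (Matrix.map (Matrix.of M) (mapRingHom (Ideal.Quotient.mk P))).det = 0 := by
      rw [← RingHom.mapMatrix_apply, ← RingHom.map_det]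
      exact hdet
    -- A kernel vector over `(R/P)[X]` lifts to a combination of the `u j` whose product with `f` is
    -- negligible; cancelling `f` contradicts independence.
    obtain ⟨b, hb0, hb⟩ := Matrix.exists_vecMul_eq_zero_iff.2 h1
    choose c hc using fun j => map_surjective _ Ideal.Quotient.mk_surjective (b j)
    have h2 : ∀ i, (∑ j, c j * M j i).map (Ideal.Quotient.mk P) = 0 := fun i => by
      have := congrFun hb i
      simpa [Matrix.vecMul, dotProduct, Polynomial.map_sum, hc] using this
    have h3 : f * ∑ j, (c j * C (s j)).map (algebraMap R K) * C (u j) =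
        ∑ i, (∑ j, c j * M j i).map (algebraMap R K) * C (v i) +
          ∑ j, (c j).map (algebraMap R K) * q j := by
      have h4 : ∑ i, (∑ j, c j * M j i).map (algebraMap R K) * C (v i) =
          ∑ j, (c j).map (algebraMap R K) * ∑ i, (M j i).map (algebraMap R K) * C (v i) := by
        simp only [Polynomial.map_sum, Polynomial.map_mul, Finset.sum_mul, Finset.mul_sum]
        rw [Finset.sum_comm]
        simp only [mul_assoc]
      rw [h4, ← Finset.sum_add_distrib, Finset.mul_sum]
      refine Finset.sum_congr rfl fun j _ => ?_
      rw [hMq, Polynomial.map_mul, Polynomial.map_C]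
      ring
    have h5 : Negligible P I (m + 1)
        (content R (f * ∑ j, (c j * C (s j)).map (algebraMap R K) * C (u j))) := by
      rw [h3]
      exact negligible_content_add
        (negligible_content_sum _ _ fun i _ => negligible_content_of_map_mul_C (h2 i) (hv.1 i))
        (negligible_content_sum _ _ fun j _ => negligible_content_map_mul (hM j) _)
    refine hb0 (funext fun j => ?_)
    have h6 := hu.polynomial (negligible_content_of_mul hf h5) j
    rw [Polynomial.map_mul, Polynomial.map_C, hc] at h6
    refine (mul_eq_zero.1 h6).resolve_right ?_
    rw [C_eq_zero, Ideal.Quotient.eq_zero_iff_mem]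
    exact hs j
  obtain ⟨t, ht, a, ha⟩ := hv.2 w hw
  set g := Matrix.det (Matrix.of M) with hg
  -- Cramer's rule expresses `g v_k` through the rows of `M`, which are multiples of `f` up to the
  -- errors `q j`.
  have hadj : ∀ k, g.map (algebraMap R K) * C (v k) = ∑ j,
      (Matrix.adjugate (Matrix.of M) k j).map (algebraMap R K) *
        ∑ i, (M j i).map (algebraMap R K) * C (v i) := by
    intro k
    have h1 : ∀ i, ∑ j, Matrix.adjugate (Matrix.of M) k j * M j i = if k = i then g else 0 := by
      intro i
      have := congrFun (congrFun (Matrix.adjugate_mul (Matrix.of M)) k) i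
      rw [Matrix.mul_apply, Matrix.smul_apply, Matrix.one_apply, smul_eq_mul, mul_ite, mul_one,
        mul_zero] at this
      exact this
    calc g.map (algebraMap R K) * C (v k)
        = ∑ i, (if k = i then g else 0).map (algebraMap R K) * C (v i) := by
          rw [Finset.sum_eq_single k]
          · simp
          · intro i _ hi
            rw [if_neg hi.symm, Polynomial.map_zero, zero_mul]
          · simp
      _ = _ := by
          simp only [← h1, Polynomial.map_sum, Polynomial.map_mul, Finset.sum_mul, Finset.mul_sum]
          rw [Finset.sum_comm]
          simp only [mul_assoc]
  -- `r k` is the quotient of `g v_k` by `f`, and `z k` the remainder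
  set r : Fin d → K[X] := fun k => ∑ j, (Matrix.adjugate (Matrix.of M) k j * C (s j)).map
    (algebraMap R K) * C (u j) with hr
  set z : Fin d → K[X] := fun k => ∑ j,
    (Matrix.adjugate (Matrix.of M) k j).map (algebraMap R K) * q j with hz
  have hgv : ∀ k, g.map (algebraMap R K) * C (v k) = f * r k - z k := by
    intro k
    rw [hadj, hr, hz, Finset.mul_sum, ← Finset.sum_sub_distrib]
    refine Finset.sum_congr rfl fun j _ => ?_
    rw [hMq, Polynomial.map_mul, Polynomial.map_C]
    ring
  have hsum : ∀ (b : Fin d → R[X]) (p : Fin d → K[X]) (N : Submodule R K),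
      (∀ i, content R (p i) ≤ N) → content R (∑ i, (b i).map (algebraMap R K) * p i) ≤ N := by
    intro b p N hp
    refine Finset.sum_induction _ (fun p => content R p ≤ N)
      (fun p q hp hq => (content_add_le p q).trans (sup_le hp hq)) (by simp [content_zero])
      fun i _ => (content_map_mul_le _ _).trans (hp i)
  refine reduces_of_negligible (g := C t * g) (h := ∑ k, (C (a k)).map (algebraMap R K) * r k)
    ?_ ?_ ?_
  · rw [Polynomial.map_mul, Polynomial.map_C]
    refine mul_ne_zero ?_ hdet
    rwa [Ne, C_eq_zero, Ideal.Quotient.eq_zero_iff_mem]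
  · refine hsum _ _ _ fun k => hsum _ _ _ fun j => ?_
    rw [content_C, Submodule.span_singleton_le_iff_mem]
    exact hu.1 j
  · have e : (C t * g).map (algebraMap R K) * C w -
        f * ∑ k, (C (a k)).map (algebraMap R K) * r k =
        g.map (algebraMap R K) * C (t • w - ∑ k, a k • v k) -
          ∑ k, (C (a k)).map (algebraMap R K) * z k := by
      have h1 : f * ∑ k, (C (a k)).map (algebraMap R K) * r k =
          g.map (algebraMap R K) * ∑ k, (C (a k)).map (algebraMap R K) * C (v k) +
            ∑ k, (C (a k)).map (algebraMap R K) * z k := by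
        rw [Finset.mul_sum, Finset.mul_sum, ← Finset.sum_add_distrib]
        refine Finset.sum_congr rfl fun k _ => ?_
        linear_combination (-(C (a k)).map (algebraMap R K)) * hgv k
      rw [h1]
      simp only [Algebra.smul_def, C_sub, map_sum, C_mul, Polynomial.map_mul, Polynomial.map_C]
      ring
    rw [e]
    refine negligible_content_sub (negligible_content_map_mul ?_ _)
      (negligible_content_sum _ _ fun k _ => negligible_content_map_mul
        (negligible_content_sum _ _ fun j _ => negligible_content_map_mul (hM j) _) _)
    rwa [content_C]

end Reduction

/-! ### From reduction modulo `P` to invertibility in the blow-up ring. -/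

section Nakayama

variable {R K : Type*} [CommRing R] [Field K] [Algebra R K]

theorem exists_eq_sum_of_mem_coeSubmodule_mul_span {P : Ideal R} {r : ℕ} {w : Fin r → K} {x : K}
    (hx : x ∈ coeSubmodule K P * Submodule.span R (Set.range w)) :
    ∃ c : Fin r → R, (∀ l, c l ∈ P) ∧ x = ∑ l, c l • w l := by
  induction hx using Submodule.mul_induction_on' with
  | mem_mul_mem a ha b hb =>
    obtain ⟨p, hp, rfl⟩ := (mem_coeSubmodule K P).1 ha
    obtain ⟨c, rfl⟩ := (Submodule.mem_span_range_iff_exists_fun R).1 hb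
    refine ⟨fun l => p * c l, fun l => P.mul_mem_right _ hp, ?_⟩
    rw [← Algebra.smul_def, Finset.smul_sum]
    simp only [mul_smul]
  | add a _ b _ ha hb =>
    obtain ⟨c, hc, rfl⟩ := ha
    obtain ⟨c', hc', rfl⟩ := hb
    refine ⟨c + c', fun l => P.add_mem (hc l) (hc' l), ?_⟩
    simp only [Pi.add_apply, add_smul, Finset.sum_add_distrib]

theorem exists_eq_sum_of_content_le {P : Ideal R} {r : ℕ} {w : Fin r → K} {p : K[X]}
    (hp : content R p ≤ coeSubmodule K P * Submodule.span R (Set.range w)) :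
    ∃ c : Fin r → R[X], (∀ l, (c l).map (Ideal.Quotient.mk P) = 0) ∧
      p = ∑ l, (c l).map (algebraMap R K) * C (w l) := by
  choose c hc hcp using fun i =>
    exists_eq_sum_of_mem_coeSubmodule_mul_span (hp (coeff_mem_content p i))
  refine ⟨fun l => ∑ i ∈ p.support, monomial i (c i l), fun l => ?_, ?_⟩
  · rw [Polynomial.map_sum]
    refine Finset.sum_eq_zero fun i _ => ?_
    rw [map_monomial, Ideal.Quotient.eq_zero_iff_mem.2 (hc i l), monomial_zero_right]
  · conv_lhs => rw [p.as_sum_support]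
    simp only [Polynomial.map_sum, Finset.sum_mul, map_monomial, monomial_mul_C]
    rw [Finset.sum_comm]
    refine Finset.sum_congr rfl fun i _ => ?_
    rw [hcp i, map_sum]
    simp only [Algebra.smul_def]

variable {P : Ideal R} [P.IsPrime] {I : Submodule R K} {f : K[X]} {m : ℕ}

/-- Nakayama's lemma for the inclusion of `f Iᵐ` into `Iᵐ⁺¹`. -/
theorem exists_map_mul_C_eq_mul (hI : I.FG) (h : ∀ w ∈ I ^ (m + 1), Reduces P I f m 0 w) :
    ∃ g : R[X], g.map (Ideal.Quotient.mk P) ≠ 0 ∧ ∀ w ∈ I ^ (m + 1),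
      ∃ q : K[X], content R q ≤ I ^ m ∧ g.map (algebraMap R K) * C w = f * q := by
  obtain ⟨r, w, hw⟩ := Submodule.fg_iff_exists_fin_generating_family.1 (hI.pow (m + 1))
  have hwI : ∀ l, w l ∈ I ^ (m + 1) := fun l => hw ▸ Submodule.subset_span (Set.mem_range_self l)
  choose g hg q hq hr using fun l => h (w l) (hwI l)
  have hr' : ∀ l, content R ((g l).map (algebraMap R K) * C (w l) - f * q l) ≤
      coeSubmodule K P * Submodule.span R (Set.range w) := fun l => by
    simpa [hw] using hr l
  choose c hc hcq using fun l => exists_eq_sum_of_content_le (hr' l)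
  -- The determinant trick: the relations read `A w = f q`. As `c` vanishes modulo `P`, `A` is
  -- diagonal there, with determinant a product of nonzero elements of the domain `(R/P)[X]`.
  set A : Matrix (Fin r) (Fin r) R[X] := Matrix.diagonal g - Matrix.of c with hA
  have hdet : A.det.map (Ideal.Quotient.mk P) = ∏ l, (g l).map (Ideal.Quotient.mk P) := by
    have h1 : (mapRingHom (Ideal.Quotient.mk P)).mapMatrix A =
        Matrix.diagonal fun l => (g l).map (Ideal.Quotient.mk P) := by
      ext1 l k
      rw [RingHom.mapMatrix_apply, Matrix.map_apply, hA, Matrix.sub_apply, map_sub, Matrix.of_apply,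
        coe_mapRingHom, hc, sub_zero, Matrix.diagonal_apply, Matrix.diagonal_apply]
      split_ifs
      · rfl
      · exact Polynomial.map_zero _
    rw [← coe_mapRingHom, RingHom.map_det, h1, Matrix.det_diagonal]
    rfl
  have hAw : ∀ l, ∑ k, (A l k).map (algebraMap R K) * C (w k) = f * q l := by
    intro l
    simp only [hA, Matrix.sub_apply, Polynomial.map_sub, sub_mul, Finset.sum_sub_distrib,
      Matrix.of_apply]
    rw [← hcq l, Finset.sum_eq_single l]
    · rw [Matrix.diagonal_apply_eq]
      ring
    · intro k _ hk
      rw [Matrix.diagonal_apply_ne _ hk.symm, Polynomial.map_zero, zero_mul]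
    · simp
  have hadj : ∀ k, A.det.map (algebraMap R K) * C (w k) =
      f * ∑ l, (A.adjugate k l).map (algebraMap R K) * q l := by
    intro k
    have h1 : ∀ i, ∑ j, A.adjugate k j * A j i = if k = i then A.det else 0 := by
      intro i
      have := congrFun (congrFun (Matrix.adjugate_mul A) k) i
      rw [Matrix.mul_apply, Matrix.smul_apply, Matrix.one_apply, smul_eq_mul, mul_ite, mul_one,
        mul_zero] at this
      exact this
    calc A.det.map (algebraMap R K) * C (w k)
        = ∑ i, (if k = i then A.det else 0).map (algebraMap R K) * C (w i) := by
          rw [Finset.sum_eq_single k]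
          · simp
          · intro i _ hi
            rw [if_neg hi.symm, Polynomial.map_zero, zero_mul]
          · simp
      _ = ∑ l, (A.adjugate k l).map (algebraMap R K) *
            ∑ i, (A l i).map (algebraMap R K) * C (w i) := by
          simp only [← h1, Polynomial.map_sum, Polynomial.map_mul, Finset.sum_mul, Finset.mul_sum]
          rw [Finset.sum_comm]
          simp only [mul_assoc]
      _ = _ := by
          simp only [hAw, Finset.mul_sum]
          exact Finset.sum_congr rfl fun l _ => by ring
  refine ⟨A.det, ?_, fun x hx => ?_⟩
  · rw [hdet]
    exact Finset.prod_ne_zero_iff.2 fun l _ => hg l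
  · rw [← hw] at hx
    induction hx using Submodule.span_induction with
    | mem x hx =>
      obtain ⟨k, rfl⟩ := hx
      exact ⟨_, Finset.sum_induction _ (fun p => content R p ≤ I ^ m)
        (fun p q hp hq => (content_add_le p q).trans (sup_le hp hq)) (by simp [content_zero])
        fun l _ => (content_map_mul_le _ _).trans (hq l), hadj k⟩
    | zero => exact ⟨0, by simp [content_zero], by simp⟩
    | add x y _ _ hx hy =>
      obtain ⟨p, hp, hp'⟩ := hx
      obtain ⟨q, hq, hq'⟩ := hy
      exact ⟨p + q, (content_add_le p q).trans (sup_le hp hq),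
        by rw [C_add, mul_add, mul_add, hp', hq']⟩
    | smul a x _ hx =>
      obtain ⟨p, hp, hp'⟩ := hx
      refine ⟨(C a).map (algebraMap R K) * p, (content_map_mul_le _ _).trans hp, ?_⟩
      rw [Algebra.smul_def, C_mul, Polynomial.map_C]
      linear_combination C (algebraMap R K a) * hp'

theorem exists_content_eq (hI : I.FG) : ∃ f : K[X], content R f = I := by
  obtain ⟨r, w, hw⟩ := Submodule.fg_iff_exists_fin_generating_family.1 hI
  refine ⟨∑ l : Fin r, monomial l (w l), le_antisymm (content_le.2 fun i => ?_) ?_⟩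
  · rw [finsetSum_coeff]
    refine sum_mem fun l _ => ?_
    rw [coeff_monomial]
    split_ifs
    · exact hw ▸ Submodule.subset_span (Set.mem_range_self l)
    · exact zero_mem _
  · rw [← hw, Submodule.span_le]
    rintro _ ⟨l, rfl⟩
    have h1 : (∑ k : Fin r, monomial (k : ℕ) (w k)).coeff l = w l := by
      rw [finsetSum_coeff, Finset.sum_eq_single l]
      · rw [coeff_monomial, if_pos rfl]
      · intro k _ hk
        rw [coeff_monomial, if_neg fun h => hk (Fin.ext h)]
      · simp
    rw [← h1]
    exact coeff_mem_content _ _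

/-- At a height one prime, a finitely generated submodule of `K` becomes invertible in its blow-up
ring `⋃ (Iᵐ : Iᵐ)`. -/
theorem exists_notMem_mem_mul_div [IsDomain R] [IsNoetherianRing R] [IsFractionRing R K]
    (hP0 : P ≠ ⊥) (hP1 : ∀ Q : Ideal R, Q.IsPrime → Q ≠ ⊥ → Q ≤ P → Q = P) (hI0 : I ≠ ⊥)
    (hI : I.FG) : ∃ m : ℕ, ∃ s ∉ P, algebraMap R K s ∈ I * (I ^ m / I ^ (m + 1)) := by
  obtain ⟨f, hf⟩ := exists_content_eq hI
  obtain ⟨e, he⟩ := exists_independent_card_le (P := P) hP0 hP1 hI0 hI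
  set D : Set ℕ := {d | ∃ (m : ℕ) (u : Fin d → K), Independent P I m u} with hD
  have hDne : D.Nonempty := ⟨0, 0, Fin.elim0, fun j => j.elim0, fun _ _ j => j.elim0⟩
  have hDb : BddAbove D := ⟨e, by rintro d ⟨m, u, hu⟩; exact he m d u hu⟩
  -- The largest rank over all degrees, attained in degree `m`; degree `m + 1` cannot exceed it, so
  -- a family of the same size generates there.
  obtain ⟨m, u, hu⟩ := Nat.sSup_mem hDne hDb
  obtain ⟨v, hv⟩ : ∃ v : Fin (sSup D) → K, Generates P I (m + 1) v := by
    refine (exists_generates_or_independent P I (m + 1) (sSup D)).resolve_right ?_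
    rintro ⟨u', hu'⟩
    exact absurd (le_csSup hDb ⟨m + 1, u', hu'⟩) (by omega)
  obtain ⟨N, hN⟩ := exists_forall_reduces (hI.pow (m + 1)) fun w hw =>
    exists_reduces_of_independent hf hu hv hw
  have hred : ∀ w ∈ I ^ (m + N + 1), Reduces P I f (m + N) 0 w := by
    intro w hw
    rw [show m + N + 1 = (m + 1) + N by ring, pow_add] at hw
    induction hw using Submodule.mul_induction_on' with
    | mem_mul_mem y hy z hz => exact (hN y hy).mul hz
    | add a _ b _ ha hb => exact ha.add hb
  obtain ⟨g, hg, hgq⟩ := exists_map_mul_C_eq_mul hI hred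
  refine ⟨m + N, ?_⟩
  obtain ⟨x, hx, hx0⟩ := exists_pow_ne_bot hI0 (m + N + 1)
  have hf0 : f ≠ 0 := by
    rintro rfl
    exact hI0 (hf ▸ content_zero)
  obtain ⟨q, -, hq⟩ := hgq x hx
  -- `p` is `g / f`, hence independent of `x`; so its coefficients multiply all of `I^(m+N+1)` into
  -- `I^(m+N)`.
  set p : K[X] := q * C x⁻¹ with hp
  have hgp : g.map (algebraMap R K) = f * p := by
    rw [hp, ← mul_assoc, ← hq, mul_assoc, ← C_mul, mul_inv_cancel₀ hx0, C_1, mul_one]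
  have hpI : content R p ≤ I ^ (m + N) / I ^ (m + N + 1) := by
    refine content_le.2 fun i => Submodule.mem_div_iff_forall_mul_mem.2 fun y hy => ?_
    obtain ⟨q', hq', hqy⟩ := hgq y hy
    have h1 : p * C y = q' := mul_left_cancel₀ hf0 (by rw [← hqy, hgp]; ring)
    rw [← coeff_mul_C, h1]
    exact content_le.1 hq' i
  obtain ⟨i, hi⟩ : ∃ i, g.coeff i ∉ P := by
    by_contra! hcon
    refine hg (Polynomial.ext fun i => ?_)
    rw [coeff_map, coeff_zero, Ideal.Quotient.eq_zero_iff_mem]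
    exact hcon i
  refine ⟨g.coeff i, hi, ?_⟩
  have h1 := (content_mul_le f p).trans (mul_le_mul' hf.le hpI) (coeff_mem_content (f * p) i)
  rwa [← hgp, coeff_map] at h1

end Nakayama

/-! ### Nonzero `t`-primes, and the passage from local to global. -/

section TPrimes

variable {R : Type*} (K : Type*) [CommRing R] [IsDomain R] [IsNoetherianRing R] [Field K]
  [Algebra R K] [IsFractionRing R K]

omit [IsDomain R] in
theorem exists_mem_iff_dvd_of_isAssociatedPrime {P : Ideal R} {a : R}
    (hP : IsAssociatedPrime P (R ⧸ Ideal.span {a})) : ∃ c : R, ∀ r, r ∈ P ↔ a ∣ r * c := by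
  obtain ⟨-, x, hx⟩ := isAssociatedPrime_iff.1 hP
  obtain ⟨c, rfl⟩ := Ideal.Quotient.mk_surjective x
  refine ⟨c, fun r => ?_⟩
  rw [hx, Submodule.mem_colon_singleton, Submodule.mem_bot, Algebra.smul_def,
    Ideal.Quotient.algebraMap_eq, ← map_mul, Ideal.Quotient.eq_zero_iff_mem,
    Ideal.mem_span_singleton]

omit [IsDomain R] in
-- Here `P = (aR : c)`. The two elements `1` and `c / a` of `P⁻¹` already cut out `P`, so `P` is
-- divisorial.
theorem isTPrime_of_isAssociatedPrime {P : Ideal R} {a : R} (ha : a ≠ 0)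
    (hP : IsAssociatedPrime P (R ⧸ Ideal.span {a})) : IsTPrime R K P ∧ P ≠ ⊥ := by
  obtain ⟨c, hc⟩ := exists_mem_iff_dvd_of_isAssociatedPrime hP
  have hinj : Function.Injective (algebraMap R K) := IsFractionRing.injective R K
  have haK : algebraMap R K a ≠ 0 := fun h => ha (hinj (by rw [h, map_zero]))
  have haP : a ∈ P := (hc a).2 (dvd_mul_right a c)
  have hq : algebraMap R K c / algebraMap R K a ∈ 1 / coeSubmodule K P := by
    refine Submodule.mem_div_iff_forall_mul_mem.2 ?_
    rintro _ ⟨r, hr, rfl⟩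
    obtain ⟨t, ht⟩ := (hc r).1 hr
    refine Submodule.mem_one.2 ⟨t, ?_⟩
    have := congrArg (algebraMap R K) ht
    rw [map_mul, map_mul] at this
    rw [Algebra.linearMap_apply]
    field_simp
    linear_combination -this
  have hv : vClosure (coeSubmodule K P) ≤ coeSubmodule K P := by
    intro x hx
    have h1 : (1 : K) ∈ 1 / coeSubmodule K P := by
      refine Submodule.mem_div_iff_forall_mul_mem.2 fun y hy => ?_
      rw [one_mul]
      exact coeSubmodule_le_one P hy
    obtain ⟨r, hr⟩ := Submodule.mem_one.1 (Submodule.mem_div_iff_forall_mul_mem.1 hx 1 h1)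
    obtain ⟨t, ht⟩ := Submodule.mem_one.1 (Submodule.mem_div_iff_forall_mul_mem.1 hx _ hq)
    rw [mul_one] at hr
    refine (mem_coeSubmodule K P).2 ⟨r, (hc r).2 ⟨t, hinj ?_⟩, hr⟩
    rw [map_mul, map_mul, hr, ht]
    field_simp
  refine ⟨⟨hP.isPrime, Or.inr ⟨?_, ?_, ?_⟩⟩, fun h => ha (by rwa [h] at haP)⟩
  · exact (Submodule.ne_bot_iff _).2 ⟨_, (mem_coeSubmodule K P).2 ⟨a, haP, rfl⟩, haK⟩
  · exact FractionalIdeal.isFractional_of_le_one _ (coeSubmodule_le_one P)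
  · exact le_antisymm (iSup_le fun F => (vClosure_mono F.2.2.2).trans hv) (le_tClosure _)

variable {K}

/-- A fraction `b / a` in the inverse of `A` but not in `R` gives a nonzero class of `b` in `R / aR`
killed by `A`; its annihilator lies in an associated prime, which is a nonzero `t`-prime. -/
theorem one_div_coeSubmodule_le_one {A : Ideal R}
    (hA : ∀ P : Ideal R, IsTPrime R K P → P ≠ ⊥ → ¬ A ≤ P) : 1 / coeSubmodule K A ≤ 1 := by
  intro q hq
  obtain ⟨b, a, ha, rfl⟩ := IsFractionRing.div_surjective (A := R) q
  have ha0 : a ≠ 0 := nonZeroDivisors.ne_zero ha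
  have hinj : Function.Injective (algebraMap R K) := IsFractionRing.injective R K
  have haK : algebraMap R K a ≠ 0 := fun h => ha0 (hinj (by rw [h, map_zero]))
  by_contra hcon
  have hb : Ideal.Quotient.mk (Ideal.span {a}) b ≠ 0 := by
    rw [Ne, Ideal.Quotient.eq_zero_iff_mem, Ideal.mem_span_singleton]
    rintro ⟨t, rfl⟩
    exact hcon (Submodule.mem_one.2 ⟨t, by rw [map_mul, mul_div_cancel_left₀ _ haK]⟩)
  obtain ⟨P, hP, hle⟩ := exists_le_isAssociatedPrime_of_isNoetherianRing R _ hb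
  obtain ⟨htP, hP0⟩ := isTPrime_of_isAssociatedPrime K ha0 hP
  refine hA P htP hP0 fun r hr => hle ?_
  rw [Submodule.mem_colon_singleton, Submodule.mem_bot, Algebra.smul_def,
    Ideal.Quotient.algebraMap_eq, ← map_mul, Ideal.Quotient.eq_zero_iff_mem,
    Ideal.mem_span_singleton]
  obtain ⟨t, ht⟩ := Submodule.mem_one.1 (Submodule.mem_div_iff_forall_mul_mem.1 hq _
    ((mem_coeSubmodule K A).2 ⟨r, hr, rfl⟩))
  refine ⟨t, hinj ?_⟩
  rw [map_mul, map_mul, ht]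
  field_simp

/-- `Q` need not be a `t`-ideal, but a prime minimal over a nonzero `x ∈ Q` is associated to `R /
xR`, hence a nonzero `t`-prime; it lies in `Q ⊆ P`, and the dimension forces it to be `P`. -/
theorem eq_of_tDim_le_one (h : tDim R K ≤ 1) {P : Ideal R} (hP : IsTPrime R K P)
    {Q : Ideal R} (hQ : Q.IsPrime) (hQ0 : Q ≠ ⊥) (hle : Q ≤ P) : Q = P := by
  obtain ⟨x, hx, hx0⟩ := (Submodule.ne_bot_iff Q).1 hQ0
  obtain ⟨Q', hQ', hle'⟩ := Ideal.exists_minimalPrimes_le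
    ((Ideal.span_singleton_le_iff_mem Q).2 hx)
  have hass : IsAssociatedPrime Q' (R ⧸ Ideal.span {x}) :=
    Module.associatedPrimes.minimalPrimes_annihilator_subset_associatedPrimes R (R ⧸ Ideal.span {x})
      (by rwa [Ideal.annihilator_quotient])
  obtain ⟨ht, hQ'0⟩ := isTPrime_of_isAssociatedPrime K hx0 hass
  refine le_antisymm hle (le_trans ?_ hle')
  rcases Order.krullDim_le_one_iff.1 h ⟨Q', ht⟩ with hmin | hmax
  · have hbot : IsTPrime R K (⊥ : Ideal R) := ⟨Ideal.isPrime_bot, Or.inl rfl⟩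
    exact absurd (le_bot_iff.1 (hmin (b := ⟨⊥, hbot⟩) (bot_le (a := Q')))) hQ'0
  · exact hmax (b := ⟨P, hP⟩) (hle'.trans hle)

theorem exists_notMem_smul_mem {I : Submodule R K} (hI : IsTIdeal I) (hL : IsLStable I)
    {P : Ideal R} [P.IsPrime] (hP0 : P ≠ ⊥)
    (hP1 : ∀ Q : Ideal R, Q.IsPrime → Q ≠ ⊥ → Q ≤ P → Q = P) :
    ∃ s ∉ P, algebraMap R K s ∈ (I / (I * I)) * (I * I) / I := by
  obtain ⟨m, s, hs, h⟩ := exists_notMem_mem_mul_div hP0 hP1 hI.1 (fg_of_isFractional hI.2.1)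
  refine ⟨s, hs, ?_⟩
  have hstab : ∀ y ∈ I ^ m / I ^ m, y ∈ I / I := by
    intro y hy
    -- Stability only concerns `n ≥ 1`; for `m = 0` the colon is `R` itself.
    rcases Nat.eq_zero_or_pos m with rfl | hm
    · rw [pow_zero] at hy
      obtain ⟨r, hr⟩ := Submodule.mem_one.1 (Submodule.mem_div_iff_forall_mul_mem.1 hy 1
        (Submodule.one_le.1 le_rfl))
      rw [mul_one] at hr
      refine mem_div_self.2 fun z hz => ?_
      rw [← hr, ← Algebra.smul_def]
      exact I.smul_mem r hz
    · have : y ∈ ⋃ (n : ℕ) (_ : 1 ≤ n), ((I ^ n / I ^ n : Submodule R K) : Set K) :=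
        Set.mem_iUnion₂.2 ⟨m, hm, hy⟩
      rw [hL] at this
      exact this
  -- Stability enters here: `(Iᵐ : Iᵐ⁺¹) I ⊆ (Iᵐ : Iᵐ) ⊆ (I : I)`.
  have hle : I ^ m / I ^ (m + 1) ≤ I / (I * I) := by
    intro y hy
    refine Submodule.mem_div_iff_forall_mul_mem.2 fun z hz => ?_
    induction hz using Submodule.mul_induction_on' with
    | mem_mul_mem a ha b hb =>
      rw [← mul_assoc]
      refine mem_div_self.1 (hstab _ (mem_div_self.2 fun c hc => ?_)) b hb
      rw [mul_assoc]
      refine Submodule.mem_div_iff_forall_mul_mem.1 hy _ ?_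
      rw [pow_succ']
      exact Submodule.mul_mem_mul ha hc
    | add a _ b _ ha hb =>
      rw [mul_add]
      exact I.add_mem ha hb
  refine Submodule.mem_div_iff_forall_mul_mem.2 fun x hx => ?_
  have h1 := Submodule.mul_mem_mul (mul_le_mul' le_rfl hle h) hx
  rwa [mul_comm I, mul_assoc] at h1

omit [IsDomain R] [IsNoetherianRing R] in
theorem exists_algebraMap_mem {I : Submodule R K} (h0 : I ≠ ⊥) :
    ∃ r : R, r ≠ 0 ∧ algebraMap R K r ∈ I := by
  obtain ⟨x, hx, hx0⟩ := (Submodule.ne_bot_iff I).1 h0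
  obtain ⟨n, t, ht, rfl⟩ := IsFractionRing.div_surjective (A := R) x
  have ht0 : algebraMap R K t ≠ 0 := fun h => hx0 (by rw [h, div_zero])
  refine ⟨n, ?_, ?_⟩
  · rintro rfl
    rw [map_zero, zero_div] at hx0
    exact hx0 rfl
  · have := I.smul_mem t hx
    rwa [Algebra.smul_def, mul_div_cancel₀ _ ht0] at this

omit [IsNoetherianRing R] in
theorem isFractional_div {I J : Submodule R K} (hI : IsFractional R⁰ I) (hJ : J ≠ ⊥) :
    IsFractional R⁰ (I / J) := by
  obtain ⟨b, hb, h⟩ := hI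
  obtain ⟨r, hr0, hr⟩ := exists_algebraMap_mem hJ
  refine ⟨b * r, mul_mem hb (mem_nonZeroDivisors_of_ne_zero hr0), fun x hx => ?_⟩
  obtain ⟨y, hy⟩ := h _ (Submodule.mem_div_iff_forall_mul_mem.1 hx _ hr)
  refine ⟨y, ?_⟩
  rw [hy, Algebra.smul_def, Algebra.smul_def, map_mul]
  ring

omit [IsNoetherianRing R] in
theorem div_ne_bot {I J : Submodule R K} (hI : I ≠ ⊥) (hJ : IsFractional R⁰ J) :
    I / J ≠ ⊥ := by
  obtain ⟨b, hb, h⟩ := hJ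
  obtain ⟨r, hr0, hr⟩ := exists_algebraMap_mem hI
  have hinj : Function.Injective (algebraMap R K) := IsFractionRing.injective R K
  refine (Submodule.ne_bot_iff _).2 ⟨algebraMap R K (r * b),
    Submodule.mem_div_iff_forall_mul_mem.2 fun y hy => ?_, fun h => ?_⟩
  · obtain ⟨t, ht⟩ := h y hy
    have := I.smul_mem t hr
    rw [Algebra.smul_def, ht, Algebra.smul_def] at this
    convert this using 1
    rw [map_mul]
    ring
  · rw [map_eq_zero_iff _ hinj] at h
    exact mul_ne_zero hr0 (nonZeroDivisors.ne_zero hb) h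

theorem tClosure_div_mul_eq (hdim : tDim R K ≤ 1) {I : Submodule R K} (hI : IsTIdeal I)
    (hL : IsLStable I) : tClosure (I / (I * I) * (I * I)) = I := by
  set F := I / (I * I) * (I * I) with hF
  have hFI : F ≤ I := Submodule.le_div_iff_mul_le.1 le_rfl
  refine le_antisymm (tClosure_le_of_le hI hFI) ?_
  -- The conductor of `I` into `F`. No nonzero `t`-prime contains it, so its `t`-closure is `R`, and
  -- `A I ⊆ F` yields `I ⊆ F_t`.
  set A : Ideal R := (F / I).comap (Algebra.linearMap R K) with hA
  have hAle : coeSubmodule K A ≤ F / I := Submodule.map_comap_le _ _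
  have hinv : 1 / coeSubmodule K A ≤ 1 := by
    refine one_div_coeSubmodule_le_one fun P hP hP0 hAP => ?_
    have := hP.1
    obtain ⟨s, hs, h⟩ := exists_notMem_smul_mem hI hL hP0
      fun Q hQ hQ0 hle => eq_of_tDim_le_one hdim hP hQ hQ0 hle
    exact hs (hAP h)
  have hF0 : F ≠ ⊥ := mul_ne_bot' (div_ne_bot hI.1 (hI.2.1.mul hI.2.1)) (mul_ne_bot' hI.1 hI.1)
  obtain ⟨r, hr0, hr⟩ := exists_algebraMap_mem (div_ne_bot hF0 hI.2.1)
  have hA0 : coeSubmodule K A ≠ ⊥ := (Submodule.ne_bot_iff _).2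
    ⟨_, (mem_coeSubmodule K A).2 ⟨r, hr, rfl⟩,
      fun h => hr0 (IsFractionRing.injective R K (by rw [h, map_zero]))⟩
  have hAfg : (coeSubmodule K A).FG := (IsNoetherian.noetherian A).map _
  have h1 : 1 ≤ tClosure (coeSubmodule K A) :=
    (vClosure_eq_one_of_one_div_le (coeSubmodule_le_one A) hinv).ge.trans
      (vClosure_le_tClosure hA0 hAfg le_rfl)
  calc I = 1 * I := (one_mul I).symm
    _ ≤ tClosure (coeSubmodule K A) * I := mul_le_mul' h1 le_rfl
    _ ≤ tClosure (coeSubmodule K A * I) := tClosure_mul_le _ _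
    _ ≤ tClosure F := tClosure_mono (Submodule.le_div_iff_mul_le.1 hAle)

end TPrimes

end TClass

theorem theorem2p2 (R K : Type*) [CommRing R] [IsDomain R] [IsNoetherianRing R]
    [Field K] [Algebra R K] [IsFractionRing R K] :
    (TClass.IsCliffordTRegular R K →
      ∀ I : Submodule R K, TClass.IsTIdeal I → TClass.IsTInvertible (TClass.overEndRing I)) ∧
    ((∀ I : Submodule R K, TClass.IsTIdeal I → TClass.IsTInvertible (TClass.overEndRing I)) →
      ∀ I : Submodule R K, TClass.IsTIdeal I → TClass.IsLStable I) ∧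
    (TClass.tDim R K = 1 →
      (∀ I : Submodule R K, TClass.IsTIdeal I → TClass.IsLStable I) →
      TClass.IsCliffordTRegular R K) := by
  refine ⟨fun h I hI => ?_, fun h I hI => TClass.isLStable_of_isTInvertible (h I hI),
    fun hdim h => TClass.isCliffordTRegular_of_forall fun I hI => ⟨I / (I * I), ?_, ?_, ?_⟩⟩
  · obtain ⟨J, hJ⟩ := TClass.exists_tClosure_mul_eq h hI
    exact TClass.isTInvertible_overEndRing hI hJ
  · exact TClass.div_ne_bot hI.1 (hI.2.1.mul hI.2.1)
  · exact TClass.isFractional_div hI.2.1 (TClass.mul_ne_bot' hI.1 hI.1)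
  · exact TClass.tClosure_div_mul_eq hdim.le hI (h I hI)
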